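/- Let $K$ be a field of characteristic zero and let $\mathcal F$ be the field of formal series $a=\sum_i a_i t^{\alpha_i}$ with $a_i\in K$ and real exponents $\alpha_0<\alpha_1<\cdots$ without limit points. Write $\|a\|$ for the least exponent occurring in $a\neq0$ (the order of $a$), $\|0\|=\infty$, and $R=\{a\in\mathcal F:\|a\|\ge 0\}$. Two pairs of $r\times r$ matrices over $\mathcal F$ lie in the same orbit if $(A,B)=(PMQ^{-1},QNT^{-1})$ with $P,Q,T\in GL_r(R)$. For real $\mu_1\ge\dots\ge\mu_r$ put $D_\mu=\mathrm{diag}(t^{\mu_1},\dots,t^{\mu_r})$; $Q\in GL_r(R)$ is called $\mu$-admissible if $D_\mu QD_\mu^{-1}\in GL_r(R)$. For $k$-element subsets $I=\{i_1<\dots<i_k\}$, $J=\{j_1<\dots<j_k\}$ of $\{1,\dots,r\}$ let $W_{IJ}$ be the minor of $W$ with rows $I$ and columns $J$, let $I\subseteq J$ mean $i_s\le j_s$ for all $s$, let $|\mu_I|=\sum_{i\in I}\mu_i$, and let $\widehat J_k=\{r-k+1,\dots,r\}$. A matrix $N^*$ is $\mu$-generic, associated to $N$, if it is upper triangular; $N^*=QNT^{-1}$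 with $T\in GL_r(R)$ and $Q$ a $\mu$-admissible matrix that can be factored over $GL_r(R)$ both as upper times lower triangular and as lower times upper triangular; and, for all $k$ and all $k$-element index sets, $$\|N^*_{IJ}\|\le\|N^*_{HJ}\|\quad\text{and}\quad \|N^*_{IJ}\|\le\|N^*_{IH}\|\qquad(I\subseteq H\subseteq J),$$ $$\|N^*_{H\widehat J_k}\|\le\|N^*_{I\widehat J_k}\|+|\mu_I|-|\mu_H|\qquad(I\subseteq H).$$ For such $N^*$ let $\|(p)^\wedge,\dots,(q)^\wedge\|$ be the order of the minor of $N^*$ obtained by omitting the rows $p,\dots,q$ and using the right-most columns (indices outside $\{1,\dots,r\}$ are ignored, and no row is omitted if $p>q$). A *right filling* of a pair $(M,N)$ of invertible $r\times r$ matrices over $\mathcal F$ is the array $(k_{ij})_{1\le i\le j\le r}$, $$k_{ij}=\|(j-i)^\wedge,\dots,(j-1)^\wedge\|-\|(j-i+1)^\wedge,\dots,(j)^\wedge\|-\Bigl(\|(j-i+1)^\wedge,\dots,(j-1)^\wedge\|-\|(j-i+2)^\wedge,\dots,(j)^\wedge\|\Bigr),$$ computed from a $\mu$-generic $N^*$ associated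 to some $N'$ with $(D_\mu,N')$ in the orbit of $(M,N)$. A *left filling* of $(M,N)$ is defined by interchanging the two matrices and rows and columns, that is, as a right filling of $(N^{T},M^{T})$. **Proposition.** Let $M,N$ be invertible $r\times r$ matrices over $\mathcal F$, let $c\in\mathcal F$, $c\ne0$, have order $\alpha=\|c\|$, and let $D(c)=\mathrm{diag}(c,\dots,c)$. The pair $(M,N)$ has exactly one right filling $(k_{ij})$, and if $(k^*_{ij})$ is the right filling of $(M,N\cdot D(c))$, then $$k^*_{ij}=k_{ij}\ \ (i<j),\qquad k^*_{ii}=k_{ii}+\alpha\ \ (1\le i\le r).$$ Analogously, $(M,N)$ has exactly one left filling $(m_{ij})$, and if $(m^*_{ij})$ is the left filling of $(D(c)\cdot M,N)$, then $m^*_{ij}=m_{ij}$ for $i<j$ and $m^*_{ii}=m_{ii}+\alpha$ for all $i$. -/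

import Mathlib

/-- The field `𝓕` of formal series `∑ aᵢ t^{αᵢ}` with coefficients in `K` and real exponents, the
exponents being bounded below and without limit points: a Hahn series lies in `𝓕` iff only
finitely many of its exponents lie below any given real number. -/
noncomputable def sparseSeries (K : Type*) [Field K] : Subfield (HahnSeries ℝ K) where
  carrier := {a | ∀ b : ℝ, (a.support ∩ Set.Iic b).Finite}
  zero_mem' := by intro b; simp
  one_mem' := by
    intro b
    refine (Set.finite_singleton (0 : ℝ)).subset ?_
    rintro x ⟨hx, -⟩
    simpa using (HahnSeries.support_single_subset (a := (0 : ℝ)) (r := (1 : K)) hx)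
  add_mem' := by
    intro x y hx hy b
    refine ((hx b).union (hy b)).subset ?_
    rintro g ⟨hg, hb⟩
    rcases HahnSeries.support_add_subset _ _ hg with h | h
    · exact Or.inl ⟨h, hb⟩
    · exact Or.inr ⟨h, hb⟩
  neg_mem' := by
    intro x hx b
    simpa [HahnSeries.support_neg] using hx b
  mul_mem' := by
    intro x y hx hy b
    refine (Set.Finite.image2 (fun i j : ℝ => i + j) (hx (b - y.order))
      (hy (b - x.order))).subset ?_
    rintro g ⟨hg, hb⟩
    obtain ⟨i, hi, j, hj, rfl⟩ := HahnSeries.support_mul_subset hg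
    have h1 : x.order ≤ i := HahnSeries.order_le_of_coeff_ne_zero hi
    have h2 : y.order ≤ j := HahnSeries.order_le_of_coeff_ne_zero hj
    have hb' : i + j ≤ b := hb
    refine ⟨i, ⟨hi, ?_⟩, j, ⟨hj, ?_⟩, rfl⟩
    · show i ≤ b - y.order
      linarith
    · show j ≤ b - x.order
      linarith
  inv_mem' := by
    intro x hx
    have hmul : ∀ u v : HahnSeries ℝ K, (∀ b : ℝ, (u.support ∩ Set.Iic b).Finite) →
        (∀ b : ℝ, (v.support ∩ Set.Iic b).Finite) →
        ∀ b : ℝ, ((u * v).support ∩ Set.Iic b).Finite := by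
      intro x y hx hy b
      refine (Set.Finite.image2 (fun i j : ℝ => i + j) (hx (b - y.order))
        (hy (b - x.order))).subset ?_
      rintro g ⟨hg, hb⟩
      obtain ⟨i, hi, j, hj, rfl⟩ := HahnSeries.support_mul_subset hg
      have h1 : x.order ≤ i := HahnSeries.order_le_of_coeff_ne_zero hi
      have h2 : y.order ≤ j := HahnSeries.order_le_of_coeff_ne_zero hj
      have hb' : i + j ≤ b := hb
      refine ⟨i, ⟨hi, ?_⟩, j, ⟨hj, ?_⟩, rfl⟩
      · show i ≤ b - y.order
        linarith
      · show j ≤ b - x.order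
        linarith
    have hsingle : ∀ (a : ℝ) (c : K) (b : ℝ),
        ((HahnSeries.single a c).support ∩ Set.Iic b).Finite := fun a c b =>
      (Set.finite_singleton a).subset
        (Set.inter_subset_left.trans HahnSeries.support_single_subset)
    have hpow : ∀ z : HahnSeries ℝ K, (∀ b : ℝ, (z.support ∩ Set.Iic b).Finite) →
        ∀ (n : ℕ) (b : ℝ), ((z ^ n).support ∩ Set.Iic b).Finite := by
      intro z hz n
      induction n with
      | zero => intro b; rw [pow_zero]; exact hsingle 0 1 b
      | succ n ih => rw [pow_succ]; exact hmul _ _ ih hz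
    by_cases hx0 : x = 0
    · subst hx0; intro b; simp
    rw [HahnSeries.inv_def]
    refine hmul _ _ (hsingle _ _) ?_
    set z : HahnSeries ℝ K := 1 - (HahnSeries.single (-x.order)) x.leadingCoeff⁻¹ * x with hzdef
    have hz0 : 0 < z.orderTop := HahnSeries.unit_aux x
      (inv_mul_cancel₀ (HahnSeries.leadingCoeff_ne_zero.mpr hx0)) _ (neg_add_cancel x.order)
    have hz : ∀ b : ℝ, (z.support ∩ Set.Iic b).Finite := by
      intro b
      have hy := hmul _ x (hsingle (-x.order) x.leadingCoeff⁻¹) hx b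
      refine ((hsingle 0 (1 : K) b).union hy).subset ?_
      rintro g ⟨hg, hb⟩
      rcases HahnSeries.support_sub_subset _ _ hg with h | h
      · exact Or.inl ⟨h, hb⟩
      · exact Or.inr ⟨h, hb⟩
    intro b
    obtain ⟨d, hd0, hd⟩ : ∃ d : ℝ, 0 < d ∧ (d : WithTop ℝ) ≤ z.orderTop := by
      cases h : z.orderTop with
      | top => exact ⟨1, one_pos, le_top⟩
      | coe d => exact ⟨d, by rw [h] at hz0; exact_mod_cast hz0, le_rfl⟩
    obtain ⟨m, hm⟩ := exists_nat_gt (b / d)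
    refine ((Finset.range m).finite_toSet.biUnion fun n _ => hpow z hz n b).subset ?_
    rintro g ⟨hg, hb⟩
    have hg' := HahnSeries.SummableFamily.support_hsum_subset hg
    obtain ⟨n, hn⟩ := Set.mem_iUnion.1 hg'
    rw [HahnSeries.SummableFamily.powers_of_orderTop_pos hz0] at hn
    refine Set.mem_iUnion₂.2 ⟨n, ?_, hn, hb⟩
    have h1 : ((n • d : ℝ) : WithTop ℝ) ≤ g := by
      calc ((n • d : ℝ) : WithTop ℝ) = n • (d : WithTop ℝ) := by rw [WithTop.coe_nsmul]
        _ ≤ n • z.orderTop := nsmul_le_nsmul_right hd n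
        _ ≤ (z ^ n).orderTop := HahnSeries.orderTop_nsmul_le_orderTop_pow
        _ ≤ g := HahnSeries.orderTop_le_of_coeff_ne_zero hn
    have h2 : (n : ℝ) * d ≤ g := by
      have := WithTop.coe_le_coe.1 h1
      simpa [nsmul_eq_mul] using this
    have hb' : g ≤ b := hb
    have h3 : (n : ℝ) < m := by
      refine lt_of_le_of_lt ?_ hm
      rw [le_div_iff₀ hd0]
      linarith
    simpa using (by exact_mod_cast h3 : n < m)

namespace ValuationFilling

variable {K : Type*} [Field K] {r : ℕ}

/-- The order `‖a‖` of a series, with `‖0‖ = ⊤`. -/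
noncomputable def ordTop (a : sparseSeries K) : WithTop ℝ := (a : HahnSeries ℝ K).orderTop

/-- The order `‖a‖` of a nonzero series, as a real number (it is only used for `a ≠ 0`). -/
noncomputable def ord (a : sparseSeries K) : ℝ := (a : HahnSeries ℝ K).order

/-- The monomial `t ^ s`. -/
noncomputable def tPow (K : Type*) [Field K] (s : ℝ) : sparseSeries K :=
  ⟨HahnSeries.single s 1, fun _ => (Set.finite_singleton s).subset
    (Set.inter_subset_left.trans HahnSeries.support_single_subset)⟩

theorem tPow_mul_tPow (s u : ℝ) : tPow K s * tPow K u = tPow K (s + u) := by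
  apply Subtype.ext
  simp [tPow]

theorem tPow_zero : tPow K 0 = 1 := rfl

/-- The valuation ring `R = {a ∈ 𝓕 : ‖a‖ ≥ 0}`. -/
noncomputable def valRing (K : Type*) [Field K] : Subring (sparseSeries K) where
  carrier := {a | 0 ≤ ordTop a}
  zero_mem' := by simp [ordTop]
  one_mem' := by simp [ordTop]
  add_mem' := by
    intro a b ha hb
    have h : min (a : HahnSeries ℝ K).orderTop (b : HahnSeries ℝ K).orderTop ≤
        ((a : HahnSeries ℝ K) + (b : HahnSeries ℝ K)).orderTop :=
      HahnSeries.min_orderTop_le_orderTop_add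
    exact le_trans (le_min ha hb) h
  neg_mem' := by
    intro a ha
    simpa [ordTop] using ha
  mul_mem' := by
    intro a b ha hb
    have h := (HahnSeries.addVal ℝ K).map_mul (a : HahnSeries ℝ K) (b : HahnSeries ℝ K)
    simp only [HahnSeries.addVal_apply] at h
    show 0 ≤ ((a * b : sparseSeries K) : HahnSeries ℝ K).orderTop
    rw [Subfield.coe_mul, h]
    exact add_nonneg ha hb

/-- `GL_r(R)`, as a subgroup of `GL_r(𝓕)`. -/
noncomputable def glR (r : ℕ) (K : Type*) [Field K] : Subgroup (GL (Fin r) (sparseSeries K)) :=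
  (Matrix.GeneralLinearGroup.map (n := Fin r) (valRing K).subtype).range

/-- `D_μ = diag(t^{μ₁}, …, t^{μᵣ})`. -/
noncomputable def diagT (K : Type*) [Field K] (μ : Fin r → ℝ) : GL (Fin r) (sparseSeries K) where
  val := Matrix.diagonal fun i => tPow K (μ i)
  inv := Matrix.diagonal fun i => tPow K (-μ i)
  val_inv := by simp [Matrix.diagonal_mul_diagonal, tPow_mul_tPow, tPow_zero]
  inv_val := by simp [Matrix.diagonal_mul_diagonal, tPow_mul_tPow, tPow_zero]

/-- The scalar matrix `D(c) = diag(c, …, c)`. -/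
noncomputable def scalarMat (r : ℕ) (c : sparseSeries K) : Matrix (Fin r) (Fin r) (sparseSeries K) :=
  Matrix.diagonal fun _ => c

/-- `(M, N)` and `(A, B)` lie in the same orbit: `(A, B) = (P M Q⁻¹, Q N T⁻¹)` for some
`P, Q, T ∈ GL_r(R)`. -/
def PairEquiv (M N A B : Matrix (Fin r) (Fin r) (sparseSeries K)) : Prop :=
  ∃ P ∈ glR r K, ∃ Q ∈ glR r K, ∃ T ∈ glR r K,
    A = P.val * M * (Q⁻¹).val ∧ B = Q.val * N * (T⁻¹).val

/-- `Q ∈ GL_r(R)` is `μ`-admissible: `D_μ Q D_μ⁻¹ ∈ GL_r(R)`. -/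
def IsAdmissible (μ : Fin r → ℝ) (Q : GL (Fin r) (sparseSeries K)) : Prop :=
  Q ∈ glR r K ∧ diagT K μ * Q * (diagT K μ)⁻¹ ∈ glR r K

def IsUpper (W : Matrix (Fin r) (Fin r) (sparseSeries K)) : Prop :=
  ∀ i j, j < i → W i j = 0

def IsLower (W : Matrix (Fin r) (Fin r) (sparseSeries K)) : Prop :=
  ∀ i j, i < j → W i j = 0

/-- The minor `W_{IJ}` with rows `I` and columns `J`; an index set of length `k` is written as
its increasing enumeration. -/
noncomputable def minor {k : ℕ} (W : Matrix (Fin r) (Fin r) (sparseSeries K)) (I J : Fin k ↪o Fin r) :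
    sparseSeries K :=
  (W.submatrix I J).det

/-- The right-most `k` columns `(r-k+1, …, r)`. -/
def lastCols {k : ℕ} (h : k ≤ r) : Fin k ↪o Fin r :=
  OrderEmbedding.ofStrictMono (fun s => ⟨r - k + s, by omega⟩) (by
    intro a b hab
    simp only [Fin.lt_def] at hab ⊢
    omega)

/-- `Nst` is a `μ`-generic matrix associated to `N`: it is upper triangular, it equals
`Q N T⁻¹` with `T ∈ GL_r(R)` and `Q` a `μ`-admissible matrix having both an upper-lower and a
lower-upper factorization over `R`, and the orders of its minors satisfy the genericity
inequalities `row`, `col` and `gap`. In `gap` the columns are the right-most ones; the order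
`‖·‖` of a vanishing minor is `⊤`. -/
structure IsMuGeneric (μ : Fin r → ℝ) (N Nst : Matrix (Fin r) (Fin r) (sparseSeries K)) :
    Prop where
  upper : IsUpper Nst
  factor : ∃ Q : GL (Fin r) (sparseSeries K), IsAdmissible μ Q ∧
    (∃ U ∈ glR r K, ∃ L ∈ glR r K, IsUpper U.val ∧ IsLower L.val ∧ Q = U * L) ∧
    (∃ L ∈ glR r K, ∃ U ∈ glR r K, IsLower L.val ∧ IsUpper U.val ∧ Q = L * U) ∧
    ∃ T ∈ glR r K, Nst = Q.val * N * (T⁻¹).val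
  row : ∀ (k : ℕ) (I H J : Fin k ↪o Fin r), (∀ s, I s ≤ H s) → (∀ s, H s ≤ J s) →
    ordTop (minor Nst I J) ≤ ordTop (minor Nst H J)
  col : ∀ (k : ℕ) (I H J : Fin k ↪o Fin r), (∀ s, I s ≤ H s) → (∀ s, H s ≤ J s) →
    ordTop (minor Nst I J) ≤ ordTop (minor Nst I H)
  gap : ∀ (k : ℕ) (hk : k ≤ r) (I H : Fin k ↪o Fin r), (∀ s, I s ≤ H s) →
    ordTop (minor Nst H (lastCols hk)) + ((∑ s, μ (H s) : ℝ) : WithTop ℝ) ≤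
      ordTop (minor Nst I (lastCols hk)) + ((∑ s, μ (I s) : ℝ) : WithTop ℝ)

/-- The rows of an `r × r` matrix with the rows numbered `p, p + 1, …, q` omitted (numbering from
`1`; numbers outside `1, …, r` are ignored, and nothing is omitted when `p > q`). -/
def omitRows (r p q : ℕ) : Finset (Fin r) :=
  Finset.univ.filter fun x : Fin r => ¬ (p ≤ (x : ℕ) + 1 ∧ (x : ℕ) + 1 ≤ q)

/-- `‖(p^, …, q^)‖`: the order of the minor of `W` in which the rows `p, …, q` are omitted and
the right-most columns are used. -/
noncomputable def omitOrd (W : Matrix (Fin r) (Fin r) (sparseSeries K)) (p q : ℕ) : ℝ :=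
  ord (minor W ((omitRows r p q).orderEmbOfFin rfl)
    (lastCols (by simpa using (omitRows r p q).card_le_univ)))

/-- The determinantal formula for `k_{ij}` (`1 ≤ i ≤ j ≤ r`, numbering from `1`). -/
noncomputable def part (W : Matrix (Fin r) (Fin r) (sparseSeries K)) (i j : ℕ) : ℝ :=
  (omitOrd W (j - i) (j - 1) - omitOrd W (j - i + 1) j) -
    (omitOrd W (j - i + 1) (j - 1) - omitOrd W (j - i + 2) j)

/-- `k` is a right filling of the pair `(M, N)`: its parts `k_{ij}`, `i ≤ j`, are given by the
determinantal formula applied to a `μ`-generic matrix `Nst` for which `(D_μ, Nst)` lies in the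
orbit of `(M, N)`. (Indices `i, j : Fin r` stand for `i + 1, j + 1`; the array is extended
by `0` to `i > j`.) -/
def IsRightFilling (M N : Matrix (Fin r) (Fin r) (sparseSeries K)) (k : Fin r → Fin r → ℝ) :
    Prop :=
  ∃ (μ : Fin r → ℝ) (N' Nst : Matrix (Fin r) (Fin r) (sparseSeries K)), Antitone μ ∧
    PairEquiv M N (diagT K μ).val N' ∧ IsMuGeneric μ N' Nst ∧
    ∀ i j : Fin r, k i j = if i ≤ j then part Nst (i + 1) (j + 1) else 0

/-- `m` is a left filling of the pair `(M, N)`: the roles of the two matrices, and of rows and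
columns, are interchanged, i.e. `m` is a right filling of `(Nᵀ, Mᵀ)`. -/
def IsLeftFilling (M N : Matrix (Fin r) (Fin r) (sparseSeries K)) (m : Fin r → Fin r → ℝ) :
    Prop :=
  IsRightFilling N.transpose M.transpose m

end ValuationFilling

/-! A filling depends only on the orders of the minors of `N*` in the right-most columns, so
uniqueness means that these orders are invariants of the orbit. The exponents `μ` are invariants
(`le_of_diagT_equiv`), so two generic matrices are related by `X₂ = S X₁ T` with `S` admissible and
`T` over `R`. Expand a minor of `S X₁ T` along rows: passing from rows `I` to rows `H` costs at
least the positive parts of `μ_H - μ_I` in the entries of `S`, the increasing matching being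
cheapest, and the inequalities `gap` and `row` say that the minors of `X₁` cannot gain more than
this cost. So orders do not drop (`le_ordTop_det_admissible_mul`), and exchanging `X₁` and `X₂`
gives equality.

Existence rests on genericity: since `K` is infinite, constants can be chosen at which finitely many
polynomials over the series field all attain their least order on `R` (`exists_generic_point`).
Hence a matrix can be multiplied by generic matrices with prescribed entry bounds so that all minors
have least order. Comparing with competitors obtained by replacing rows or columns turns minimality
into inequalities between different minors (`exists_generic_product`). This yields the form `D_μ`,
and then `N*` in two rounds (`exists_isMuGeneric`): admissible factors give `gap`, and upper
triangular factors give `row` and `col` while keeping the right-most minors at the same orders.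

Scaling `N` by `c` scales `N*` by `c`, which adds `k * ord c` to the order of a `k × k` minor. The
sizes of the four minors in the formula cancel for `i < j` and leave one `ord c` for `i = j`. Left
fillings follow by transposition. -/

namespace ValuationFilling

open Matrix

/-! ### Orders, constants and coefficients of series. -/

section Order

variable {K : Type*} [Field K] {r : ℕ}

/-- The order as an additive valuation on the field of series. -/
noncomputable def ordVal (K : Type*) [Field K] : AddValuation (sparseSeries K) (WithTop ℝ) :=
  (HahnSeries.addVal ℝ K).comap (sparseSeries K).subtype

theorem ordVal_apply (a : sparseSeries K) : ordVal K a = ordTop a := by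
  change (HahnSeries.addVal ℝ K) (a : HahnSeries ℝ K) = _
  rw [HahnSeries.addVal_apply, ordTop]

@[simp] theorem ordTop_zero : ordTop (0 : sparseSeries K) = ⊤ := by
  simp [ordTop]

@[simp] theorem ordTop_one : ordTop (1 : sparseSeries K) = 0 := by
  simp [ordTop]

theorem ordTop_mul (a b : sparseSeries K) : ordTop (a * b) = ordTop a + ordTop b := by
  simp only [← ordVal_apply, (ordVal K).map_mul]

theorem ordTop_pow (a : sparseSeries K) (n : ℕ) : ordTop (a ^ n) = n • ordTop a := by
  simp only [← ordVal_apply, (ordVal K).map_pow]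

@[simp] theorem ordTop_neg (a : sparseSeries K) : ordTop (-a) = ordTop a := by
  simp only [← ordVal_apply, (ordVal K).map_neg]

theorem ordTop_eq_top {a : sparseSeries K} : ordTop a = ⊤ ↔ a = 0 := by
  rw [← ordVal_apply, (ordVal K).top_iff]

theorem ordTop_eq_ord {a : sparseSeries K} (ha : a ≠ 0) : ordTop a = ord a := by
  have h : (a : HahnSeries ℝ K) ≠ 0 := fun h => ha (Subtype.ext h)
  exact (HahnSeries.order_eq_orderTop_of_ne_zero h).symm

theorem ord_mul {a b : sparseSeries K} (ha : a ≠ 0) (hb : b ≠ 0) :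
    ord (a * b) = ord a + ord b := by
  have h := ordTop_mul a b
  rw [ordTop_eq_ord ha, ordTop_eq_ord hb, ordTop_eq_ord (mul_ne_zero ha hb)] at h
  exact_mod_cast h

theorem ord_one : ord (1 : sparseSeries K) = 0 := by
  have h := ordTop_one (K := K)
  rw [ordTop_eq_ord one_ne_zero] at h
  exact_mod_cast h

theorem ord_pow {a : sparseSeries K} (ha : a ≠ 0) (n : ℕ) : ord (a ^ n) = n * ord a := by
  induction n with
  | zero => simp [ord_one]
  | succ n ih => rw [pow_succ, ord_mul (pow_ne_zero n ha) ha, ih]; push_cast; ring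

@[simp] theorem ordTop_tPow (s : ℝ) : ordTop (tPow K s) = s :=
  HahnSeries.orderTop_single one_ne_zero

theorem tPow_ne_zero (s : ℝ) : tPow K s ≠ 0 := by
  intro h
  have := ordTop_tPow (K := K) s
  simp [h] at this

theorem le_ordTop_sum {ι : Type*} {s : Finset ι} {f : ι → sparseSeries K} {b : WithTop ℝ}
    (h : ∀ i ∈ s, b ≤ ordTop (f i)) : b ≤ ordTop (∑ i ∈ s, f i) := by
  rw [← ordVal_apply]
  exact (ordVal K).map_le_sum fun i hi => (ordVal_apply (f i)).symm ▸ h i hi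

theorem lt_ordTop_sum {ι : Type*} {s : Finset ι} {f : ι → sparseSeries K} {b : WithTop ℝ}
    (hb : b < ⊤) (h : ∀ i ∈ s, b < ordTop (f i)) : b < ordTop (∑ i ∈ s, f i) := by
  rw [← ordVal_apply]
  exact (ordVal K).map_lt_sum' hb fun i hi => (ordVal_apply (f i)).symm ▸ h i hi

theorem ordTop_prod {ι : Type*} (s : Finset ι) (f : ι → sparseSeries K) :
    ordTop (∏ i ∈ s, f i) = ∑ i ∈ s, ordTop (f i) := by
  classical
  induction s using Finset.induction_on with
  | empty => simp
  | insert a s ha ih => rw [Finset.prod_insert ha, Finset.sum_insert ha, ordTop_mul, ih]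

theorem ordTop_sign_smul {k : Type*} [Fintype k] [DecidableEq k] (σ : Equiv.Perm k)
    (a : sparseSeries K) : ordTop (Equiv.Perm.sign σ • a) = ordTop a := by
  rcases Int.units_eq_one_or (Equiv.Perm.sign σ) with h | h <;> simp [h]

/-- A constant, as a series. -/
noncomputable def const (K : Type*) [Field K] : K →+* sparseSeries K :=
  (HahnSeries.C : K →+* HahnSeries ℝ K).codRestrict (sparseSeries K) fun a _ =>
    (Set.finite_singleton 0).subset
      (Set.inter_subset_left.trans (HahnSeries.support_single_subset (a := (0 : ℝ)) (r := a)))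

theorem ordTop_const_nonneg (a : K) : 0 ≤ ordTop (const K a) := by
  change 0 ≤ (HahnSeries.single (0 : ℝ) a).orderTop
  exact HahnSeries.orderTop_single_le

/-- The coefficient of `t ^ g`. -/
noncomputable def coeffAt (K : Type*) [Field K] (g : ℝ) : sparseSeries K →+ K where
  toFun a := (a : HahnSeries ℝ K).coeff g
  map_zero' := rfl
  map_add' _ _ := rfl

theorem coeffAt_const_mul (g : ℝ) (a : K) (b : sparseSeries K) :
    coeffAt K g (const K a * b) = a * coeffAt K g b := by
  change ((HahnSeries.C a : HahnSeries ℝ K) * (b : HahnSeries ℝ K)).coeff g = _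
  rw [HahnSeries.C_mul_eq_smul]
  rfl

theorem ordTop_le_of_coeffAt_ne_zero {g : ℝ} {a : sparseSeries K} (h : coeffAt K g a ≠ 0) :
    ordTop a ≤ g :=
  HahnSeries.orderTop_le_of_coeff_ne_zero h

theorem coeffAt_ord_ne_zero {a : sparseSeries K} (ha : a ≠ 0) : coeffAt K (ord a) a ≠ 0 := by
  have h : (a : HahnSeries ℝ K) ≠ 0 := fun h => ha (Subtype.ext h)
  exact fun h0 => HahnSeries.coeff_order_eq_zero.not.mpr h h0

end Order

/-! ### Generic constants for polynomials over the series field. -/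

section Generic

variable {K : Type*} [Field K] {σ : Type*}

/-- The polynomial over `K` formed by the coefficients at `t ^ g` of the coefficients of `F`. -/
noncomputable def coeffPoly (g : ℝ) (F : MvPolynomial σ (sparseSeries K)) : MvPolynomial σ K :=
  ∑ m ∈ F.support, MvPolynomial.monomial m (coeffAt K g (F.coeff m))

theorem coeff_coeffPoly (g : ℝ) (F : MvPolynomial σ (sparseSeries K)) (m : σ →₀ ℕ) :
    (coeffPoly g F).coeff m = coeffAt K g (F.coeff m) := by
  classical
  rw [coeffPoly, MvPolynomial.coeff_sum]
  simp only [MvPolynomial.coeff_monomial, Finset.sum_ite_eq', MvPolynomial.mem_support_iff, ne_eq,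
    ite_not, ite_eq_right_iff]
  intro h
  simp [h]

theorem coeffAt_eval_const (g : ℝ) (F : MvPolynomial σ (sparseSeries K)) (x : σ → K) :
    coeffAt K g (MvPolynomial.eval (fun s => const K (x s)) F) =
      MvPolynomial.eval x (coeffPoly g F) := by
  rw [MvPolynomial.eval_eq, coeffPoly, map_sum, map_sum]
  refine Finset.sum_congr rfl fun m _ => ?_
  rw [MvPolynomial.eval_monomial]
  simp only [← map_pow, ← map_prod]
  rw [mul_comm, coeffAt_const_mul, mul_comm, Finsupp.prod]

/-- Constants can be chosen at which finitely many polynomials over the field of series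
simultaneously attain the least order they take on the valuation ring. -/
theorem exists_generic_point [Infinite K] {S : Set (MvPolynomial σ (sparseSeries K))}
    (hS : S.Finite) : ∃ x₀ : σ → K, ∀ F ∈ S, ∀ x : σ → sparseSeries K,
      (∀ s, 0 ≤ ordTop (x s)) →
      ordTop (MvPolynomial.eval (fun s => const K (x₀ s)) F) ≤ ordTop (MvPolynomial.eval x F) := by
  classical
  have key : ∀ F : MvPolynomial σ (sparseSeries K), ∃ f : MvPolynomial σ K, f ≠ 0 ∧
      ∀ x₀ : σ → K, MvPolynomial.eval x₀ f ≠ 0 → ∀ x : σ → sparseSeries K,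
      (∀ s, 0 ≤ ordTop (x s)) → ordTop (MvPolynomial.eval (fun s => const K (x₀ s)) F) ≤
        ordTop (MvPolynomial.eval x F) := by
    intro F
    by_cases hF : F = 0
    · exact ⟨1, one_ne_zero, fun _ _ _ _ => by simp [hF]⟩
    -- The least order of a coefficient bounds every value of `F` at integral points from below; it
    -- is attained at constants where the layer of coefficients at that order does not vanish.
    obtain ⟨m, hm, hmin⟩ := F.support.exists_min_image (fun m => ord (F.coeff m))
      (MvPolynomial.support_nonempty.2 hF)
    refine ⟨coeffPoly (ord (F.coeff m)) F, ?_, ?_⟩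
    · intro h
      have := coeff_coeffPoly (ord (F.coeff m)) F m
      rw [h, MvPolynomial.coeff_zero] at this
      exact coeffAt_ord_ne_zero (MvPolynomial.mem_support_iff.1 hm) this.symm
    · intro x₀ hx₀ x hx
      rw [← coeffAt_eval_const] at hx₀
      refine (ordTop_le_of_coeffAt_ne_zero hx₀).trans ?_
      rw [MvPolynomial.eval_eq]
      refine le_ordTop_sum fun m' hm' => ?_
      rw [ordTop_mul, ordTop_prod, ordTop_eq_ord (MvPolynomial.mem_support_iff.1 hm')]
      refine le_add_of_le_of_nonneg (by exact_mod_cast hmin m' hm') (Finset.sum_nonneg fun s _ => ?_)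
      rw [ordTop_pow]
      exact nsmul_nonneg (hx s) _
  choose f hf0 hf using key
  -- One point serves all of `S`: a nonzero polynomial over an infinite field has a non-root,
  -- applied to the product.
  have hprod : ∏ F ∈ hS.toFinset, f F ≠ 0 := Finset.prod_ne_zero_iff.2 fun F _ => hf0 F
  obtain ⟨x₀, hx₀⟩ : ∃ x₀ : σ → K, MvPolynomial.eval x₀ (∏ F ∈ hS.toFinset, f F) ≠ 0 := by
    by_contra! h
    exact hprod (MvPolynomial.funext fun x => by rw [h x, map_zero])
  refine ⟨x₀, fun F hF => hf F x₀ ?_⟩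
  rw [map_prod] at hx₀
  exact Finset.prod_ne_zero_iff.1 hx₀ F (hS.mem_toFinset.2 hF)

end Generic

/-! ### Matrices with bounded entries and their generic members. -/

section Bounded

variable {K : Type*} [Field K] {r : ℕ}

/-- The entries of `P` have at least the orders prescribed by `e`. -/
def Bounded (e : Fin r → Fin r → WithTop ℝ) (P : Matrix (Fin r) (Fin r) (sparseSeries K)) : Prop :=
  ∀ i j, e i j ≤ ordTop (P i j)

/-- The entries of `P` lie in the valuation ring. -/
abbrev Integral (P : Matrix (Fin r) (Fin r) (sparseSeries K)) : Prop :=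
  Bounded (fun _ _ => 0) P

theorem integral_one : Integral (1 : Matrix (Fin r) (Fin r) (sparseSeries K)) := by
  intro i j
  by_cases h : i = j <;> simp [Matrix.one_apply, h]

theorem Integral.mul {P Q : Matrix (Fin r) (Fin r) (sparseSeries K)} (hP : Integral P)
    (hQ : Integral Q) : Integral (P * Q) := by
  intro i j
  rw [Matrix.mul_apply]
  refine le_ordTop_sum fun a _ => ?_
  rw [ordTop_mul]
  exact add_nonneg (hP i a) (hQ a j)

theorem ordTop_det_nonneg {k : ℕ} {P : Matrix (Fin k) (Fin k) (sparseSeries K)}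
    (hP : ∀ i j, 0 ≤ ordTop (P i j)) : 0 ≤ ordTop P.det := by
  rw [Matrix.det_apply]
  refine le_ordTop_sum fun σ _ => ?_
  rw [ordTop_sign_smul, ordTop_prod]
  exact Finset.sum_nonneg fun i _ => hP _ _

/-- The inverse of a determinant of order `0` lies in `R`. Only `≤ 0` is asked because minimality
arguments compare with the identity and deliver just that. -/
theorem exists_mem_glR {W : Matrix (Fin r) (Fin r) (sparseSeries K)} (hW : Integral W)
    (hdet : ordTop W.det ≤ 0) : ∃ g ∈ glR r K, g.val = W := by
  have hdet0 : ordTop W.det = 0 := le_antisymm hdet (ordTop_det_nonneg hW)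
  have hne : W.det ≠ 0 := by
    intro h
    simp [h] at hdet
  have hinv : 0 ≤ ordTop (W.det)⁻¹ := by
    have h := ordTop_mul W.det (W.det)⁻¹
    rw [mul_inv_cancel₀ hne, ordTop_one, hdet0, zero_add] at h
    exact h.le
  let V : Matrix (Fin r) (Fin r) (valRing K) := Matrix.of fun i j => ⟨W i j, hW i j⟩
  have hV : V.map (valRing K).subtype = W := rfl
  have hVdet : ((V.det : valRing K) : sparseSeries K) = W.det := by
    rw [← hV]
    exact RingHom.map_det (valRing K).subtype V
  have hu : IsUnit V.det := by
    refine IsUnit.of_mul_eq_one (⟨(W.det)⁻¹, hinv⟩ : valRing K) (Subtype.ext ?_)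
    change (V.det : sparseSeries K) * (W.det)⁻¹ = 1
    rw [hVdet, mul_inv_cancel₀ hne]
  exact ⟨_, ⟨Matrix.GeneralLinearGroup.mk'' V hu, rfl⟩, hV⟩

theorem integral_of_mem_glR {g : GL (Fin r) (sparseSeries K)} (hg : g ∈ glR r K) :
    Integral g.val := by
  obtain ⟨h, rfl⟩ := hg
  intro i j
  exact (h.val i j).2

theorem ordTop_det_of_mem_glR {g : GL (Fin r) (sparseSeries K)} (hg : g ∈ glR r K) :
    ordTop g.val.det = 0 := by
  refine le_antisymm ?_ (ordTop_det_nonneg (integral_of_mem_glR hg))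
  have h : ordTop g.val.det + ordTop (g⁻¹).val.det = 0 := by
    rw [← ordTop_mul, ← Matrix.det_mul, ← Units.val_mul, mul_inv_cancel]
    simp
  rw [← h]
  exact le_add_of_nonneg_right (ordTop_det_nonneg (integral_of_mem_glR (inv_mem hg)))

/-- `t ^ e`, with the convention `t ^ ⊤ = 0`. -/
noncomputable def scale (K : Type*) [Field K] (e : WithTop ℝ) : sparseSeries K :=
  e.recTopCoe 0 fun s => tPow K s

theorem ordTop_scale (e : WithTop ℝ) : ordTop (scale K e) = e := by
  cases e with
  | top => exact ordTop_zero
  | coe s => exact ordTop_tPow s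

theorem exists_eq_mul_scale {e : WithTop ℝ} {a : sparseSeries K} (h : e ≤ ordTop a) :
    ∃ x : sparseSeries K, 0 ≤ ordTop x ∧ x * scale K e = a := by
  cases e with
  | top => exact ⟨0, by simp, by rw [zero_mul, ordTop_eq_top.1 (top_le_iff.1 h)]⟩
  | coe s =>
    refine ⟨a * tPow K (-s), ?_, ?_⟩
    · rw [ordTop_mul, ordTop_tPow]
      have := add_le_add_left h ((-s : ℝ) : WithTop ℝ)
      rwa [← WithTop.coe_add, add_neg_cancel] at this
    · change a * tPow K (-s) * tPow K s = a
      rw [mul_assoc, tPow_mul_tPow, neg_add_cancel, tPow_zero, mul_one]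

theorem eval_det_submatrix {σ : Type*} {k : ℕ} (x : σ → sparseSeries K)
    (W : Matrix (Fin r) (Fin r) (MvPolynomial σ (sparseSeries K))) (f g : Fin k → Fin r) :
    MvPolynomial.eval x (W.submatrix f g).det =
      ((W.map (MvPolynomial.eval x)).submatrix f g).det :=
  RingHom.map_det _ _

/-- There are matrices `P₀`, `V₀` within prescribed bounds for which all minors of `P₀ Y V₀`, of
`P₀ Z` and of `V₀` have the least possible orders. -/
theorem exists_generic_matrices [Infinite K] (e₁ e₂ : Fin r → Fin r → WithTop ℝ)
    (Y Z : Matrix (Fin r) (Fin r) (sparseSeries K)) :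
    ∃ P₀ V₀ : Matrix (Fin r) (Fin r) (sparseSeries K), Bounded e₁ P₀ ∧ Bounded e₂ V₀ ∧
      ∀ k ≤ r, ∀ f g : Fin k → Fin r, ∀ P V, Bounded e₁ P → Bounded e₂ V →
        ordTop ((P₀ * Y * V₀).submatrix f g).det ≤ ordTop ((P * Y * V).submatrix f g).det ∧
        ordTop ((P₀ * Z).submatrix f g).det ≤ ordTop ((P * Z).submatrix f g).det ∧
        ordTop (V₀.submatrix f g).det ≤ ordTop (V.submatrix f g).det := by
  let A := MvPolynomial ((Fin r × Fin r) ⊕ (Fin r × Fin r)) (sparseSeries K)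
  -- Each entry is an independent variable times `t ^ e`, so integral values of the variables
  -- produce exactly the matrices within the bounds; a bound `⊤` forces a zero entry.
  let Pp : Matrix (Fin r) (Fin r) A := Matrix.of fun i j =>
    MvPolynomial.X (Sum.inl (i, j)) * MvPolynomial.C (scale K (e₁ i j))
  let Vp : Matrix (Fin r) (Fin r) A := Matrix.of fun i j =>
    MvPolynomial.X (Sum.inr (i, j)) * MvPolynomial.C (scale K (e₂ i j))
  let W : Fin 3 → Matrix (Fin r) (Fin r) A :=
    ![Pp * Y.map MvPolynomial.C * Vp, Pp * Z.map MvPolynomial.C, Vp]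
  let S : Set A := Set.range fun p : Fin 3 × (Σ k : Fin (r + 1), (Fin k → Fin r) × (Fin k → Fin r)) =>
    ((W p.1).submatrix p.2.2.1 p.2.2.2).det
  obtain ⟨x₀, hx₀⟩ := exists_generic_point (S := S) (Set.finite_range _)
  have hC : ∀ (x : (Fin r × Fin r) ⊕ (Fin r × Fin r) → sparseSeries K)
      (Y : Matrix (Fin r) (Fin r) (sparseSeries K)),
      (Y.map (MvPolynomial.C : sparseSeries K → A)).map (MvPolynomial.eval x) = Y := by
    intro x Y
    ext1 i j
    exact MvPolynomial.eval_C _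
  refine ⟨Pp.map (MvPolynomial.eval fun s => const K (x₀ s)),
    Vp.map (MvPolynomial.eval fun s => const K (x₀ s)), ?_, ?_, ?_⟩
  · intro i j
    simp only [Pp, Matrix.map_apply, Matrix.of_apply, map_mul, MvPolynomial.eval_X,
      MvPolynomial.eval_C, ordTop_mul, ordTop_scale]
    exact le_add_of_nonneg_left (ordTop_const_nonneg _)
  · intro i j
    simp only [Vp, Matrix.map_apply, Matrix.of_apply, map_mul, MvPolynomial.eval_X,
      MvPolynomial.eval_C, ordTop_mul, ordTop_scale]
    exact le_add_of_nonneg_left (ordTop_const_nonneg _)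
  · intro k hk f g P V hP hV
    choose xP hxP hxP' using fun i j => exists_eq_mul_scale (hP i j)
    choose xV hxV hxV' using fun i j => exists_eq_mul_scale (hV i j)
    let x : (Fin r × Fin r) ⊕ (Fin r × Fin r) → sparseSeries K :=
      Sum.elim (fun p => xP p.1 p.2) fun p => xV p.1 p.2
    have hPx : Pp.map (MvPolynomial.eval x) = P := by
      ext1 i j
      simp only [Pp, Matrix.map_apply, Matrix.of_apply, map_mul, MvPolynomial.eval_X,
        MvPolynomial.eval_C, x, Sum.elim_inl, hxP']
    have hVx : Vp.map (MvPolynomial.eval x) = V := by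
      ext1 i j
      simp only [Vp, Matrix.map_apply, Matrix.of_apply, map_mul, MvPolynomial.eval_X,
        MvPolynomial.eval_C, x, Sum.elim_inr, hxV']
    have main : ∀ n : Fin 3, ordTop (((W n).map
          (MvPolynomial.eval fun s => const K (x₀ s))).submatrix f g).det ≤
        ordTop (((W n).map (MvPolynomial.eval x)).submatrix f g).det := by
      intro n
      have := hx₀ _ ⟨(n, ⟨⟨k, Nat.lt_succ_of_le hk⟩, f, g⟩), rfl⟩ x (by
        rintro (p | p)
        · exact hxP _ _
        · exact hxV _ _)
      rwa [eval_det_submatrix, eval_det_submatrix] at this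
    refine ⟨?_, ?_, ?_⟩
    · have h := main 0
      rw [show W 0 = Pp * Y.map MvPolynomial.C * Vp from rfl] at h
      simpa only [Matrix.map_mul, hC, hPx, hVx] using h
    · have h := main 1
      rw [show W 1 = Pp * Z.map MvPolynomial.C from rfl] at h
      simpa only [Matrix.map_mul, hC, hPx] using h
    · have h := main 2
      rwa [show W 2 = Vp from rfl, hVx] at h

end Bounded

/-! ### Triangular matrices and triangularization over the valuation ring. -/

section Triangular

variable {K : Type*} [Field K] {r : ℕ}

theorem IsUpper.det_eq {n : ℕ} {W : Matrix (Fin n) (Fin n) (sparseSeries K)} (h : IsUpper W) :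
    W.det = ∏ i, W i i :=
  Matrix.det_of_isUpperTriangular fun i j hij => h i j hij

theorem IsLower.transpose {n : ℕ} {W : Matrix (Fin n) (Fin n) (sparseSeries K)} (h : IsLower W) :
    IsUpper Wᵀ := fun i j hij => h j i hij

theorem IsUpper.transpose {n : ℕ} {W : Matrix (Fin n) (Fin n) (sparseSeries K)} (h : IsUpper W) :
    IsLower Wᵀ := fun i j hij => h j i hij

theorem IsLower.det_eq {n : ℕ} {W : Matrix (Fin n) (Fin n) (sparseSeries K)} (h : IsLower W) :
    W.det = ∏ i, W i i := by
  rw [← Matrix.det_transpose, h.transpose.det_eq]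
  rfl

theorem IsUpper.mul {V W : Matrix (Fin r) (Fin r) (sparseSeries K)} (hV : IsUpper V)
    (hW : IsUpper W) : IsUpper (V * W) := by
  intro i j hij
  rw [Matrix.mul_apply]
  refine Finset.sum_eq_zero fun a _ => ?_
  rcases lt_or_ge a i with h | h
  · rw [hV i a h, zero_mul]
  · rw [hW a j (hij.trans_le h), mul_zero]

theorem IsLower.mul {V W : Matrix (Fin r) (Fin r) (sparseSeries K)} (hV : IsLower V)
    (hW : IsLower W) : IsLower (V * W) := by
  have h := hW.transpose.mul hV.transpose
  rw [← Matrix.transpose_mul] at h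
  exact h.transpose

theorem IsUpper.inv {g : GL (Fin r) (sparseSeries K)} (h : IsUpper g.val) :
    IsUpper (g⁻¹).val := by
  have : Invertible g.val := g.isUnit.invertible
  have hb : Matrix.BlockTriangular g.val id := fun i j hij => h i j hij
  rw [Matrix.coe_units_inv]
  exact fun i j hij => Matrix.blockTriangular_inv_of_blockTriangular hb hij

theorem IsLower.inv {g : GL (Fin r) (sparseSeries K)} (h : IsLower g.val) :
    IsLower (g⁻¹).val := by
  have : Invertible g.val := g.isUnit.invertible
  have hb : Matrix.BlockTriangular g.val OrderDual.toDual := fun i j hij => h i j hij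
  rw [Matrix.coe_units_inv]
  exact fun i j hij => Matrix.blockTriangular_inv_of_blockTriangular hb hij

theorem sum_eq_sum_castLE_add {A : Type*} [AddCommMonoid A] (i : Fin r) (F : Fin r → A)
    (hF : ∀ j, i < j → F j = 0) :
    ∑ j, F j = ∑ a : Fin i, F (Fin.castLE i.2.le a) + F i := by
  rw [← Finset.sum_filter_add_sum_filter_not Finset.univ (fun j => j < i)]
  congr 1
  · symm
    refine Finset.sum_bij (fun a _ => Fin.castLE i.2.le a) ?_ ?_ ?_ ?_
    · intro a _
      exact Finset.mem_filter.2 ⟨Finset.mem_univ _, a.2⟩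
    · intro a _ b _ h
      simpa [Fin.ext_iff] using h
    · intro b hb
      simp only [Finset.mem_filter, Finset.mem_univ, true_and, Fin.lt_def] at hb
      exact ⟨⟨b, hb⟩, Finset.mem_univ _, rfl⟩
    · intro a _
      rfl
  · refine Finset.sum_eq_single_of_mem i (by simp) fun j hj hne => hF j ?_
    simp only [Finset.mem_filter, Finset.mem_univ, true_and, not_lt] at hj
    exact lt_of_le_of_ne hj (Ne.symm hne)

/-- A matrix whose leading principal minors have the least orders among all minors with the same
columns can be brought to upper triangular form by a lower unitriangular matrix over `R`. -/
theorem exists_lower_mul_isUpper (W : Matrix (Fin r) (Fin r) (sparseSeries K))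
    (hne : ∀ (k : ℕ) (hk : k ≤ r), (W.submatrix (Fin.castLE hk) (Fin.castLE hk)).det ≠ 0)
    (hle : ∀ (k : ℕ) (hk : k ≤ r) (f : Fin k → Fin r),
      ordTop (W.submatrix (Fin.castLE hk) (Fin.castLE hk)).det ≤
        ordTop (W.submatrix f (Fin.castLE hk)).det) :
    ∃ L ∈ glR r K, IsLower L.val ∧ (∀ i, L.val i i = 1) ∧ IsUpper (L.val * W) := by
  -- Row `i` of `L` left of the diagonal solves a linear system whose matrix is the leading `i × i`
  -- block. In Cramer's rule each numerator is a minor of `W` with one row exchanged for row `i`, so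
  -- the quotient is integral by `hle`.
  have hrow : ∀ i : Fin r, ∃ x : Fin i → sparseSeries K, (∀ a, 0 ≤ ordTop (x a)) ∧
      ∀ c : Fin i, ∑ a, x a * W (Fin.castLE i.2.le a) (Fin.castLE i.2.le c) +
        W i (Fin.castLE i.2.le c) = 0 := by
    intro i
    set A := W.submatrix (Fin.castLE i.2.le) (Fin.castLE i.2.le) with hA
    let b : Fin i → sparseSeries K := fun c => W i (Fin.castLE i.2.le c)
    have hA0 : A.det ≠ 0 := hne i i.2.le
    refine ⟨fun a => -((A.det)⁻¹ * Matrix.cramer Aᵀ b a), fun a => ?_, fun c => ?_⟩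
    · have hsub : A.updateRow a b =
          W.submatrix (Function.update (Fin.castLE i.2.le) a i) (Fin.castLE i.2.le) := by
        ext1 p q
        by_cases hp : p = a
        · subst hp
          simp [b]
        · simp [hp, hA]
      have hmin : ordTop A.det ≤ ordTop (Matrix.cramer Aᵀ b a) := by
        rw [Matrix.cramer_transpose_apply, hsub]
        exact hle i i.2.le _
      have h1 : ordTop A.det + ordTop (A.det)⁻¹ = 0 := by
        rw [← ordTop_mul, mul_inv_cancel₀ hA0, ordTop_one]
      rw [ordTop_neg, ordTop_mul, ← h1, add_comm]
      gcongr
    · have h := congrFun (Matrix.mulVec_cramer Aᵀ b) c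
      simp only [Matrix.mulVec, dotProduct, Matrix.transpose_apply, Matrix.det_transpose,
        Pi.smul_apply, smul_eq_mul] at h
      have h2 : ∑ a, -((A.det)⁻¹ * Matrix.cramer Aᵀ b a) *
          W (Fin.castLE i.2.le a) (Fin.castLE i.2.le c) =
          -((A.det)⁻¹ * ∑ a, A a c * Matrix.cramer Aᵀ b a) := by
        rw [Finset.mul_sum, ← Finset.sum_neg_distrib]
        refine Finset.sum_congr rfl fun a _ => ?_
        simp only [hA, Matrix.submatrix_apply]
        ring
      rw [h2, h, inv_mul_cancel_left₀ hA0]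
      simp [b]
  choose x hx0 hx using hrow
  let L : Matrix (Fin r) (Fin r) (sparseSeries K) := Matrix.of fun i j =>
    if h : j < i then x i ⟨j, h⟩ else if j = i then 1 else 0
  have hL : IsLower L := by
    intro i j hij
    simp [L, hij.not_gt, hij.ne']
  have hL1 : ∀ i, L i i = 1 := by
    intro i
    simp [L]
  have hLi : Integral L := by
    intro i j
    simp only [L, Matrix.of_apply]
    split_ifs
    · exact hx0 _ _
    · simp
    · simp
  obtain ⟨g, hg, hgL⟩ := exists_mem_glR hLi (by rw [hL.det_eq]; simp [hL1])
  rw [← hgL] at hL hL1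
  refine ⟨g, hg, hL, hL1, fun i c hc => ?_⟩
  rw [Matrix.mul_apply, sum_eq_sum_castLE_add i _ fun j hj => by rw [hL i j hj, zero_mul], hL1,
    one_mul]
  have h := hx i ⟨c, hc⟩
  rw [← h]
  congr 1
  refine Finset.sum_congr rfl fun a _ => ?_
  have : g.val i (Fin.castLE i.2.le a) = x i a := by
    rw [hgL]
    have ha : Fin.castLE i.2.le a < i := a.2
    simp [L, ha]
  rw [this]
  rfl

/-- The column version, with trailing principal minors, of `exists_lower_mul_isUpper`. -/
theorem exists_mul_lower_isUpper (W : Matrix (Fin r) (Fin r) (sparseSeries K))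
    (hne : ∀ (k : ℕ) (hk : k ≤ r), (W.submatrix (Fin.rev ∘ Fin.castLE hk)
      (Fin.rev ∘ Fin.castLE hk)).det ≠ 0)
    (hle : ∀ (k : ℕ) (hk : k ≤ r) (f : Fin k → Fin r),
      ordTop (W.submatrix (Fin.rev ∘ Fin.castLE hk) (Fin.rev ∘ Fin.castLE hk)).det ≤
        ordTop (W.submatrix (Fin.rev ∘ Fin.castLE hk) f).det) :
    ∃ T ∈ glR r K, IsLower T.val ∧ (∀ i, T.val i i = 1) ∧ IsUpper (W * T.val) := by
  have hsub : ∀ {k : ℕ} (f g : Fin k → Fin r),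
      ((W.submatrix Fin.rev Fin.rev)ᵀ.submatrix f g).det =
        (W.submatrix (Fin.rev ∘ g) (Fin.rev ∘ f)).det := by
    intro k f g
    rw [← Matrix.det_transpose]
    rfl
  -- Transposing and reversing both index orders turns trailing minors into leading ones and column
  -- operations into row operations, and it preserves the triangular shapes.
  obtain ⟨L, hL, hlow, hdiag, hup⟩ := exists_lower_mul_isUpper (W.submatrix Fin.rev Fin.rev)ᵀ
    (fun k hk => by rw [hsub]; exact hne k hk)
    (fun k hk f => by rw [hsub, hsub]; exact hle k hk _)
  have hT : IsLower (L.valᵀ.submatrix Fin.rev Fin.rev) :=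
    fun i j hij => hlow _ _ (Fin.rev_lt_rev.2 hij)
  have hT1 : ∀ i, (L.valᵀ.submatrix Fin.rev Fin.rev) i i = 1 := fun i => hdiag _
  obtain ⟨g, hg, hgv⟩ := exists_mem_glR (W := L.valᵀ.submatrix Fin.rev Fin.rev)
    (fun i j => integral_of_mem_glR hL _ _) (by rw [hT.det_eq]; simp [hdiag])
  rw [← hgv] at hT hT1
  refine ⟨g, hg, hT, hT1, fun i j hij => ?_⟩
  rw [hgv, ← hup (Fin.rev j) (Fin.rev i) (Fin.rev_lt_rev.2 hij), Matrix.mul_apply, Matrix.mul_apply,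
    ← Equiv.sum_comp Fin.revPerm]
  refine Finset.sum_congr rfl fun a _ => ?_
  simp [mul_comm]

end Triangular

/-! ### Orders of minors of products. -/

section Minors

variable {K : Type*} [Field K] {r : ℕ}

/-- Multilinearity in the rows: a Cauchy–Binet expansion before terms are grouped, so that the
bounds on individual entries of `S` remain usable. -/
theorem le_ordTop_det_mul_submatrix {k : ℕ} {S Y : Matrix (Fin r) (Fin r) (sparseSeries K)}
    {I J : Fin k → Fin r} {b : WithTop ℝ}
    (h : ∀ f : Fin k → Fin r,
      b ≤ ∑ s, ordTop (S (I s) (f s)) + ordTop (Y.submatrix f J).det) :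
    b ≤ ordTop ((S * Y).submatrix I J).det := by
  have hexp : ((S * Y).submatrix I J).det =
      ∑ f : Fin k → Fin r, (∏ s, S (I s) (f s)) * (Y.submatrix f J).det := by
    have hrows : (S * Y).submatrix I J = fun s => ∑ a, S (I s) a • fun t => Y a (J t) := by
      funext s t
      simp [Matrix.mul_apply, Finset.sum_apply]
    change Matrix.detRowAlternating.toMultilinearMap ((S * Y).submatrix I J) = _
    rw [hrows, MultilinearMap.map_sum]
    refine Finset.sum_congr rfl fun f _ => ?_
    rw [MultilinearMap.map_smul_univ]
    rfl
  rw [hexp]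
  refine le_ordTop_sum fun f _ => ?_
  rw [ordTop_mul, ordTop_prod]
  exact h f

theorem le_ordTop_det_mul_integral_submatrix {k : ℕ}
    {Y T : Matrix (Fin r) (Fin r) (sparseSeries K)} {I J : Fin k → Fin r} {b : WithTop ℝ}
    (hT : Integral T) (h : ∀ f : Fin k → Fin r, b ≤ ordTop (Y.submatrix I f).det) :
    b ≤ ordTop ((Y * T).submatrix I J).det := by
  rw [← Matrix.det_transpose, Matrix.transpose_submatrix, Matrix.transpose_mul]
  refine le_ordTop_det_mul_submatrix fun f => ?_
  refine le_add_of_nonneg_of_le (Finset.sum_nonneg fun s _ => hT _ _) ?_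
  rw [← Matrix.det_transpose, Matrix.transpose_submatrix, Matrix.transpose_transpose]
  exact h f

theorem exists_orderEmbedding_comp_perm {k : ℕ} {f : Fin k → Fin r} (hf : Function.Injective f) :
    ∃ (h : Fin k ↪o Fin r) (σ : Equiv.Perm (Fin k)), f = h ∘ σ := by
  have hm : StrictMono (f ∘ Tuple.sort f) :=
    (Tuple.monotone_sort f).strictMono_of_injective (hf.comp (Tuple.sort f).injective)
  refine ⟨OrderEmbedding.ofStrictMono _ hm, (Tuple.sort f)⁻¹, ?_⟩
  funext s
  simp

theorem det_submatrix_eq_zero_of_not_injective {k : ℕ}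
    (Y : Matrix (Fin r) (Fin r) (sparseSeries K)) {f : Fin k → Fin r} (J : Fin k → Fin r)
    (hf : ¬ Function.Injective f) : (Y.submatrix f J).det = 0 := by
  simp only [Function.Injective, not_forall] at hf
  obtain ⟨a, b, hab, hne⟩ := hf
  refine Matrix.det_zero_of_row_eq hne ?_
  funext t
  simp [hab]

theorem ordTop_det_submatrix_comp_perm {k : ℕ} (Y : Matrix (Fin r) (Fin r) (sparseSeries K))
    (f J : Fin k → Fin r) (σ : Equiv.Perm (Fin k)) :
    ordTop (Y.submatrix (f ∘ σ) J).det = ordTop (Y.submatrix f J).det := by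
  have h := Matrix.det_permute σ (Y.submatrix f J)
  rw [Matrix.submatrix_submatrix] at h
  change ordTop (Y.submatrix (f ∘ σ) (J ∘ id)).det = _
  rw [h]
  rcases Int.units_eq_one_or (Equiv.Perm.sign σ) with h | h <;> simp [h]

/-- Repeated columns give a zero minor, and sorting distinct ones changes only the sign. -/
theorem le_ordTop_det_submatrix {k : ℕ} {Y : Matrix (Fin r) (Fin r) (sparseSeries K)}
    {I : Fin k → Fin r} {b : WithTop ℝ}
    (h : ∀ G : Fin k ↪o Fin r, b ≤ ordTop (Y.submatrix I G).det) (f : Fin k → Fin r) :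
    b ≤ ordTop (Y.submatrix I f).det := by
  rw [← Matrix.det_transpose, Matrix.transpose_submatrix]
  by_cases hf : Function.Injective f
  · obtain ⟨G, σ, rfl⟩ := exists_orderEmbedding_comp_perm hf
    rw [ordTop_det_submatrix_comp_perm, ← Matrix.det_transpose, Matrix.transpose_submatrix]
    exact h G
  · rw [det_submatrix_eq_zero_of_not_injective _ _ hf]
    simp

/-- Pigeonhole: otherwise `σ` would inject the indices up to `s` into those strictly below `s`. -/
theorem exists_le_and_le_perm {k : ℕ} (σ : Equiv.Perm (Fin k)) (s : Fin k) :
    ∃ c ≤ s, s ≤ σ c := by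
  by_contra! h
  have hc := Finset.card_le_card_of_injOn (s := Finset.Iic s) (t := Finset.Iio s) σ
    (fun c hc => by simpa using h c (by simpa using hc)) σ.injective.injOn
  simp at hc

/-- If `G s < I s`, the rows from `s` on and the columns up to `s` span a zero block that every
permutation meets. -/
theorem minor_eq_zero_of_isUpper {k : ℕ} {Y : Matrix (Fin r) (Fin r) (sparseSeries K)}
    (hY : IsUpper Y) {I G : Fin k ↪o Fin r} (h : ¬ ∀ s, I s ≤ G s) :
    (Y.submatrix I G).det = 0 := by
  simp only [not_forall, not_le] at h
  obtain ⟨s, hs⟩ := h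
  rw [Matrix.det_apply]
  refine Finset.sum_eq_zero fun σ _ => ?_
  obtain ⟨c, hc, hσ⟩ := exists_le_and_le_perm σ s
  rw [Finset.prod_eq_zero (Finset.mem_univ c), smul_zero]
  exact hY _ _ (((G.monotone hc).trans_lt hs).trans_le (I.monotone hσ))

theorem le_lastCols {k : ℕ} (hk : k ≤ r) (G : Fin k ↪o Fin r) (s : Fin k) :
    G s ≤ lastCols hk s := by
  have hc := Finset.card_le_card_of_injOn (s := Finset.Ioi s) (t := Finset.Ioi (G s)) G
    (fun c hc => by simpa using hc) G.injective.injOn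
  rw [Fin.card_Ioi, Fin.card_Ioi] at hc
  rw [Fin.le_def]
  change (G s : ℕ) ≤ r - k + s
  omega

/-- The bounds on the entries of `μ`-admissible matrices. -/
noncomputable abbrev admissibleBound (μ : Fin r → ℝ) (i j : Fin r) : WithTop ℝ :=
  ((max 0 (μ j - μ i) : ℝ) : WithTop ℝ)

/-- Telescoping over the consecutive drops of `μ` between `a` and `b`. Each summand separates `a`
from `b`, which makes the rearrangement inequality applicable termwise. -/
theorem max_zero_sub_eq_sum {μ : Fin r → ℝ} (hμ : Antitone μ) :
    ∃ d : ℕ → ℝ, (∀ t, 0 ≤ d t) ∧ ∀ a b : Fin r, max 0 (μ a - μ b) =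
      ∑ t ∈ Finset.range r, d t * ((if (a : ℕ) ≤ t then 1 else 0) * if t < (b : ℕ) then 1 else 0) := by
  let m : ℕ → ℝ := fun t => if h : t < r then μ ⟨t, h⟩ else 0
  refine ⟨fun t => if t + 1 < r then m t - m (t + 1) else 0, fun t => ?_, fun a b => ?_⟩
  · dsimp only
    split_ifs with h
    · simp only [m, h, t.lt_succ_self.trans h, dif_pos, sub_nonneg]
      exact hμ (by simp [Fin.le_def])
    · exact le_rfl
  · have hfil : ∑ t ∈ Finset.range r, (if t + 1 < r then m t - m (t + 1) else 0) *
        ((if (a : ℕ) ≤ t then (1 : ℝ) else 0) * if t < (b : ℕ) then 1 else 0) =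
        ∑ t ∈ Finset.Ico (a : ℕ) b, (m t - m (t + 1)) := by
      have hsub : Finset.Ico (a : ℕ) b ⊆ Finset.range r := by
        intro t ht
        rw [Finset.mem_Ico] at ht
        exact Finset.mem_range.2 (ht.2.trans b.2)
      symm
      refine (Finset.sum_congr rfl fun t ht => ?_).trans
        (Finset.sum_subset hsub fun t _ ht => ?_)
      · rw [Finset.mem_Ico] at ht
        have h1 : t + 1 < r := lt_of_le_of_lt ht.2 b.2
        simp [ht.1, ht.2, h1]
      · simp only [Finset.mem_Ico, not_and, not_lt] at ht
        by_cases h : (a : ℕ) ≤ t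
        · simp [(ht h).not_gt]
        · simp [h]
    rw [hfil]
    rcases le_total a b with h | h
    · rw [Finset.sum_Ico_eq_sub _ h, Finset.sum_range_sub', Finset.sum_range_sub',
        max_eq_right (sub_nonneg.2 (hμ h))]
      simp [m]
    · rw [Finset.Ico_eq_empty_of_le (show (b : ℕ) ≤ a from h), Finset.sum_empty, max_eq_left (sub_nonpos.2 (hμ h))]

/-- Among all matchings of two index sets, the increasing one has the least total excess. -/
theorem sum_max_zero_sub_le {μ : Fin r → ℝ} (hμ : Antitone μ) {k : ℕ} (H I : Fin k ↪o Fin r)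
    (σ : Equiv.Perm (Fin k)) :
    ∑ s, max 0 (μ (H s) - μ (I s)) ≤ ∑ s, max 0 (μ (H (σ s)) - μ (I s)) := by
  obtain ⟨d, hd, hsum⟩ := max_zero_sub_eq_sum hμ
  simp only [hsum]
  rw [Finset.sum_comm, Finset.sum_comm (s := Finset.univ (α := Fin k))]
  refine Finset.sum_le_sum fun t _ => ?_
  rw [← Finset.mul_sum, ← Finset.mul_sum]
  refine mul_le_mul_of_nonneg_left ?_ (hd t)
  have hf : Antitone fun s => if (H s : ℕ) ≤ t then (1 : ℝ) else 0 := by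
    intro a b hab
    have h : (H a : ℕ) ≤ H b := H.monotone hab
    dsimp only
    split_ifs <;> first | omega | norm_num
  have hg : Monotone fun s => if t < (I s : ℕ) then (1 : ℝ) else 0 := by
    intro a b hab
    have h : (I a : ℕ) ≤ I b := I.monotone hab
    dsimp only
    split_ifs <;> first | omega | norm_num
  -- Rearrangement: one indicator decreases and the other increases along the index sets, so the
  -- identity matching gives the least sum.
  exact (hf.antivary hg).sum_mul_le_sum_comp_perm_mul (σ := σ)

/-- The orders of minors do not drop below a bound that satisfies the genericity inequalities
when the matrix is multiplied by an admissible matrix and by a matrix over `R`. -/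
theorem le_ordTop_det_admissible_mul {μ : Fin r → ℝ} (hμ : Antitone μ)
    {S W T : Matrix (Fin r) (Fin r) (sparseSeries K)} {k : ℕ} {w : (Fin k ↪o Fin r) → WithTop ℝ}
    (hW : ∀ (I : Fin k ↪o Fin r) (J : Fin k → Fin r), w I ≤ ordTop (W.submatrix I J).det)
    (hrow : ∀ I H : Fin k ↪o Fin r, (∀ s, I s ≤ H s) → w I ≤ w H)
    (hgap : ∀ I H : Fin k ↪o Fin r, (∀ s, I s ≤ H s) →
      w H + ((∑ s, μ (H s) : ℝ) : WithTop ℝ) ≤ w I + ((∑ s, μ (I s) : ℝ) : WithTop ℝ))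
    (hS : Bounded (admissibleBound μ) S) (hT : Integral T) (I : Fin k ↪o Fin r)
    (J : Fin k → Fin r) : w I ≤ ordTop ((S * W * T).submatrix I J).det := by
  refine le_ordTop_det_mul_integral_submatrix hT fun J => ?_
  refine le_ordTop_det_mul_submatrix fun f => ?_
  by_cases hf : Function.Injective f
  swap
  · rw [det_submatrix_eq_zero_of_not_injective _ _ hf]
    simp
  obtain ⟨H, σ, rfl⟩ := exists_orderEmbedding_comp_perm hf
  rw [ordTop_det_submatrix_comp_perm]
  -- The termwise minimum lies below both `H` and `I`: `gap` compares `G` with `I` at exactly the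
  -- cost of the increasing matching, and `row` passes from `G` to `H`.
  let G : Fin k ↪o Fin r := OrderEmbedding.ofStrictMono (fun s => min (H s) (I s))
    fun a b hab => min_lt_min (H.strictMono hab) (I.strictMono hab)
  have hG : ∀ s, μ (G s) = μ (I s) + max 0 (μ (H s) - μ (I s)) := by
    intro s
    change μ (min (H s) (I s)) = _
    rcases le_total (H s) (I s) with h | h
    · rw [min_eq_left h, max_eq_right (sub_nonneg.2 (hμ h))]
      ring
    · rw [min_eq_right h, max_eq_left (sub_nonpos.2 (hμ h)), add_zero]
  have h1 := hgap G I fun s => min_le_right _ _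
  have h2 : w G ≤ ordTop (W.submatrix H J).det :=
    (hrow G H fun s => min_le_left _ _).trans (hW H J)
  have h3 : ((∑ s, max 0 (μ (H s) - μ (I s)) : ℝ) : WithTop ℝ) ≤
      ∑ s, ordTop (S (I s) ((H ∘ σ) s)) := by
    refine (WithTop.coe_le_coe.2 (sum_max_zero_sub_le hμ H I σ)).trans ?_
    rw [WithTop.coe_sum]
    exact Finset.sum_le_sum fun s _ => hS _ _
  refine le_trans ?_ (add_le_add h3 h2)
  simp only [hG, Finset.sum_add_distrib] at h1
  rw [WithTop.coe_add, add_comm _ (((∑ s, max 0 (μ (H s) - μ (I s)) : ℝ)) : WithTop ℝ), ← add_assoc,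
    WithTop.add_le_add_iff_right WithTop.coe_ne_top, add_comm (w G)] at h1
  exact h1

end Minors

/-! ### Admissible matrices and invariance of the right-most minors. -/

section Uniqueness

variable {K : Type*} [Field K] {r : ℕ}

theorem conj_diagT_apply (μ : Fin r → ℝ) (Q : GL (Fin r) (sparseSeries K)) (i j : Fin r) :
    (diagT K μ * Q * (diagT K μ)⁻¹).val i j = tPow K (μ i) * Q.val i j * tPow K (-μ j) := by
  change (Matrix.diagonal (fun i => tPow K (μ i)) * Q.val *
    Matrix.diagonal fun i => tPow K (-μ i)) i j = _
  rw [Matrix.mul_diagonal, Matrix.diagonal_mul]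

theorem ordTop_conj_diagT (μ : Fin r → ℝ) (Q : GL (Fin r) (sparseSeries K)) (i j : Fin r) :
    ordTop ((diagT K μ * Q * (diagT K μ)⁻¹).val i j) =
      ordTop (Q.val i j) + ((μ i - μ j : ℝ) : WithTop ℝ) := by
  rw [conj_diagT_apply, ordTop_mul, ordTop_mul, ordTop_tPow, ordTop_tPow, sub_eq_add_neg,
    WithTop.coe_add, add_comm (μ i : WithTop ℝ), add_assoc]

/-- Conjugation by `D_μ` adds `μ i - μ j` to the order of the entry `(i, j)`; both this order and
the original one are nonnegative. -/
theorem IsAdmissible.bounded {μ : Fin r → ℝ} {Q : GL (Fin r) (sparseSeries K)}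
    (h : IsAdmissible μ Q) : Bounded (admissibleBound μ) Q.val := by
  intro i j
  have h1 : 0 ≤ ordTop (Q.val i j) := integral_of_mem_glR h.1 i j
  have h2 : 0 ≤ ordTop ((diagT K μ * Q * (diagT K μ)⁻¹).val i j) := integral_of_mem_glR h.2 i j
  rw [ordTop_conj_diagT] at h2
  cases hq : ordTop (Q.val i j) with
  | top => exact le_top
  | coe q =>
    rw [hq] at h1 h2
    rw [← WithTop.coe_add] at h2
    have h1' : 0 ≤ q := by exact_mod_cast h1
    have h2' : 0 ≤ q + (μ i - μ j) := by exact_mod_cast h2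
    exact WithTop.coe_le_coe.2 (max_le h1' (by linarith))

theorem isAdmissible_of_bounded {μ : Fin r → ℝ} {Q : GL (Fin r) (sparseSeries K)}
    (hQ : Q ∈ glR r K) (h : Bounded (admissibleBound μ) Q.val) : IsAdmissible μ Q := by
  refine ⟨hQ, ?_⟩
  have hint : Integral (diagT K μ * Q * (diagT K μ)⁻¹).val := by
    intro i j
    rw [ordTop_conj_diagT]
    have h1 : ((μ j - μ i : ℝ) : WithTop ℝ) ≤ ordTop (Q.val i j) :=
      (WithTop.coe_le_coe.2 (le_max_right _ _)).trans (h i j)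
    have h2 := add_le_add_left h1 ((μ i - μ j : ℝ) : WithTop ℝ)
    rw [← WithTop.coe_add] at h2
    simpa using h2
  have hdet : ordTop (diagT K μ * Q * (diagT K μ)⁻¹).val.det ≤ 0 := by
    rw [Units.val_mul, Units.val_mul, Matrix.det_units_conj, ordTop_det_of_mem_glR hQ]
  obtain ⟨g, hg, hgv⟩ := exists_mem_glR hint hdet
  rwa [Units.ext hgv] at hg

theorem IsAdmissible.mul {μ : Fin r → ℝ} {P Q : GL (Fin r) (sparseSeries K)}
    (hP : IsAdmissible μ P) (hQ : IsAdmissible μ Q) : IsAdmissible μ (P * Q) := by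
  refine ⟨mul_mem hP.1 hQ.1, ?_⟩
  have h := mul_mem hP.2 hQ.2
  rwa [show diagT K μ * P * (diagT K μ)⁻¹ * (diagT K μ * Q * (diagT K μ)⁻¹) =
    diagT K μ * (P * Q) * (diagT K μ)⁻¹ by group] at h

theorem IsAdmissible.inv {μ : Fin r → ℝ} {Q : GL (Fin r) (sparseSeries K)}
    (hQ : IsAdmissible μ Q) : IsAdmissible μ Q⁻¹ := by
  refine ⟨inv_mem hQ.1, ?_⟩
  have h := inv_mem hQ.2
  rwa [show (diagT K μ * Q * (diagT K μ)⁻¹)⁻¹ = diagT K μ * Q⁻¹ * (diagT K μ)⁻¹ by group] at h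

theorem IsMuGeneric.ordTop_minor_le {μ : Fin r → ℝ} (hμ : Antitone μ)
    {N X S T : Matrix (Fin r) (Fin r) (sparseSeries K)} (hX : IsMuGeneric μ N X)
    (hS : Bounded (admissibleBound μ) S) (hT : Integral T) {k : ℕ} (hk : k ≤ r)
    (I : Fin k ↪o Fin r) :
    ordTop (minor X I (lastCols hk)) ≤ ordTop (minor (S * X * T) I (lastCols hk)) := by
  refine le_ordTop_det_admissible_mul hμ (w := fun I => ordTop (minor X I (lastCols hk)))
    (fun I J => le_ordTop_det_submatrix (fun G => ?_) J)
    (fun I H h => hX.row k I H (lastCols hk) h fun s => le_lastCols hk H s)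
    (fun I H h => hX.gap k hk I H h) hS hT I _
  -- `col` covers the column sets above `I`; for all others the minor of an upper triangular matrix
  -- vanishes.
  by_cases h : ∀ s, I s ≤ G s
  · exact hX.col k I G (lastCols hk) h fun s => le_lastCols hk G s
  · rw [minor_eq_zero_of_isUpper hX.upper h]
    simp

/-- If `ν i < μ i`, the entries of `P` in rows `≤ i` and columns `≥ i` have positive order. Every
permutation meets this block, so `det P` would have positive order. -/
theorem le_of_diagT_equiv {μ ν : Fin r → ℝ} (hμ : Antitone μ) (hν : Antitone ν)
    {P Q : GL (Fin r) (sparseSeries K)} (hP : P ∈ glR r K) (hQ : Q ∈ glR r K)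
    (h : P * diagT K ν = diagT K μ * Q) : μ ≤ ν := by
  intro i
  by_contra! hi
  have hent : ∀ a ≤ i, ∀ b, i ≤ b → 0 < ordTop (P.val a b) := by
    intro a ha b hb
    have he : P.val a b * tPow K (ν b) = tPow K (μ a) * Q.val a b := by
      have := congrFun (congrFun (congrArg (fun g : GL (Fin r) (sparseSeries K) => g.val) h) a) b
      change (P.val * Matrix.diagonal fun i => tPow K (ν i)) a b =
        ((Matrix.diagonal fun i => tPow K (μ i)) * Q.val) a b at this
      rwa [Matrix.mul_diagonal, Matrix.diagonal_mul] at this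
    have ho := congrArg ordTop he
    rw [ordTop_mul, ordTop_mul, ordTop_tPow, ordTop_tPow] at ho
    have hq := integral_of_mem_glR hQ a b
    have h1 : (μ a : WithTop ℝ) ≤ ordTop (P.val a b) + ν b := by
      rw [ho]
      exact le_add_of_nonneg_right hq
    cases hp : ordTop (P.val a b) with
    | top => exact WithTop.coe_lt_top _
    | coe p =>
      rw [hp, ← WithTop.coe_add] at h1
      have h2 : μ a ≤ p + ν b := by exact_mod_cast h1
      have h3 : 0 < p := by linarith [hμ ha, hν hb]
      exact_mod_cast h3
  have hdet : 0 < ordTop P.val.det := by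
    rw [Matrix.det_apply]
    refine lt_ordTop_sum (WithTop.coe_lt_top 0) fun σ _ => ?_
    rw [ordTop_sign_smul, ordTop_prod]
    obtain ⟨c, hc, hσ⟩ := exists_le_and_le_perm σ⁻¹ i
    have hpos : 0 < ordTop (P.val (σ (σ⁻¹ c)) (σ⁻¹ c)) := by
      rw [← Equiv.Perm.mul_apply, mul_inv_cancel, Equiv.Perm.one_apply]
      exact hent c hc _ hσ
    exact hpos.trans_le (Finset.single_le_sum
      (f := fun a => ordTop (P.val (σ a) a))
      (fun a _ => integral_of_mem_glR hP _ _) (Finset.mem_univ _))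
  exact hdet.ne' (ordTop_det_of_mem_glR hP)

theorem det_units_ne_zero (g : GL (Fin r) (sparseSeries K)) : g.val.det ≠ 0 :=
  ((Matrix.isUnit_iff_isUnit_det _).1 g.isUnit).ne_zero

/-- All the data computed from a generic matrix by means of right-most minors are invariants of
the orbit of the pair. -/
theorem ordTop_minor_le_of_pairEquiv {M N : Matrix (Fin r) (Fin r) (sparseSeries K)}
    {μ ν : Fin r → ℝ} {N₁ N₂ X₁ X₂ : Matrix (Fin r) (Fin r) (sparseSeries K)}
    (hM : M.det ≠ 0) (hμ : Antitone μ) (hν : Antitone ν)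
    (h₁ : PairEquiv M N (diagT K μ).val N₁) (h₂ : PairEquiv M N (diagT K ν).val N₂)
    (hX₁ : IsMuGeneric μ N₁ X₁) (hX₂ : IsMuGeneric ν N₂ X₂) {k : ℕ} (hk : k ≤ r)
    (I : Fin k ↪o Fin r) :
    ordTop (minor X₁ I (lastCols hk)) ≤ ordTop (minor X₂ I (lastCols hk)) := by
  obtain ⟨P₁, hP₁, Q₁, hQ₁, T₁, hT₁, hD₁, hN₁⟩ := h₁
  obtain ⟨P₂, hP₂, Q₂, hQ₂, T₂, hT₂, hD₂, hN₂⟩ := h₂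
  let m : GL (Fin r) (sparseSeries K) := Matrix.GeneralLinearGroup.mkOfDetNeZero M hM
  have hD₁' : diagT K μ = P₁ * m * Q₁⁻¹ := Units.ext hD₁
  have hD₂' : diagT K ν = P₂ * m * Q₂⁻¹ := Units.ext hD₂
  have hμν : μ = ν := by
    refine le_antisymm
      (le_of_diagT_equiv hμ hν (P := P₁ * P₂⁻¹) (Q := Q₁ * Q₂⁻¹) (mul_mem hP₁ (inv_mem hP₂))
        (mul_mem hQ₁ (inv_mem hQ₂)) ?_)
      (le_of_diagT_equiv hν hμ (P := P₂ * P₁⁻¹) (Q := Q₂ * Q₁⁻¹) (mul_mem hP₂ (inv_mem hP₁))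
        (mul_mem hQ₂ (inv_mem hQ₁)) ?_)
    · rw [hD₁', hD₂']
      group
    · rw [hD₁', hD₂']
      group
  subst hμν
  obtain ⟨A₁, hA₁, -, -, B₁, hB₁, hXe₁⟩ := hX₁.factor
  obtain ⟨A₂, hA₂, -, -, B₂, hB₂, hXe₂⟩ := hX₂.factor
  -- Both pairs have the same `D_μ`, so conjugating the change of basis by `D_μ` gives the change
  -- `P₂ * P₁⁻¹` on the outer side.
  have hS : IsAdmissible μ (Q₂ * Q₁⁻¹) := by
    refine ⟨mul_mem hQ₂ (inv_mem hQ₁), ?_⟩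
    have : diagT K μ * (Q₂ * Q₁⁻¹) * (diagT K μ)⁻¹ = P₂ * P₁⁻¹ := by
      calc _ = diagT K μ * (Q₂ * Q₁⁻¹) * (P₁ * m * Q₁⁻¹)⁻¹ := by rw [← hD₁']
        _ = P₂ * m * Q₂⁻¹ * (Q₂ * Q₁⁻¹) * (P₁ * m * Q₁⁻¹)⁻¹ := by rw [← hD₂']
        _ = _ := by group
    rw [this]
    exact mul_mem hP₂ (inv_mem hP₁)
  have hX : X₂ = (A₂ * (Q₂ * Q₁⁻¹) * A₁⁻¹).val * X₁ * (B₁ * (T₁ * T₂⁻¹) * B₂⁻¹).val := by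
    rw [hXe₂, hXe₁, hN₂, hN₁]
    simp only [Units.val_mul, ← mul_assoc, Units.inv_mul_cancel_right]
  rw [hX]
  exact hX₁.ordTop_minor_le hμ ((hA₂.mul hS).mul hA₁.inv).bounded
    (integral_of_mem_glR (mul_mem (mul_mem hB₁ (mul_mem hT₁ (inv_mem hT₂))) (inv_mem hB₂))) hk I

end Uniqueness

/-! ### Diagonal form and existence of generic matrices. -/

section Existence

variable {K : Type*} [Field K] {r : ℕ}

/-- The rows with prescribed indices of a matrix within given bounds can be prescribed. -/
theorem exists_bounded_rows {e : Fin r → Fin r → WithTop ℝ} {k : ℕ} {I : Fin k → Fin r}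
    (hI : Function.Injective I) {R : Fin k → Fin r → sparseSeries K}
    (hR : ∀ s j, e (I s) j ≤ ordTop (R s j)) :
    ∃ P : Matrix (Fin r) (Fin r) (sparseSeries K), Bounded e P ∧ ∀ s, P (I s) = R s := by
  refine ⟨Function.extend I R 0, fun i j => ?_, fun s => hI.extend_apply _ _ _⟩
  by_cases h : ∃ s, I s = i
  · obtain ⟨s, rfl⟩ := h
    rw [hI.extend_apply]
    exact hR s j
  · rw [Function.extend_apply' _ _ _ h]
    simp

/-- Putting `t ^ x s` times row `I' s` of `P₀` in place of row `I s` gives a competitor within the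
bounds, whose minor on the rows `I` is `t ^ (∑ x s)` times the minor on `I'`. With `x = 0` this
gives `row`, with differences of `μ` it gives `gap`. -/
theorem ordTop_det_le_of_minimal_rows {e : Fin r → Fin r → WithTop ℝ} {k : ℕ}
    {I I' J : Fin k → Fin r} {P₀ Z : Matrix (Fin r) (Fin r) (sparseSeries K)}
    (hP₀ : Bounded e P₀)
    (hmin : ∀ P, Bounded e P →
      ordTop ((P₀ * Z).submatrix I J).det ≤ ordTop ((P * Z).submatrix I J).det)
    (hI : Function.Injective I) {x : Fin k → ℝ} (hx : ∀ s j, e (I s) j ≤ x s + e (I' s) j) :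
    ordTop ((P₀ * Z).submatrix I J).det ≤
      ((∑ s, x s : ℝ) : WithTop ℝ) + ordTop ((P₀ * Z).submatrix I' J).det := by
  obtain ⟨P, hP, hPI⟩ := exists_bounded_rows (e := e) hI
    (R := fun s j => tPow K (x s) * P₀ (I' s) j) fun s j => by
      rw [ordTop_mul, ordTop_tPow]
      exact (hx s j).trans (by gcongr; exact hP₀ _ _)
  refine (hmin P hP).trans_eq ?_
  have hsub : (P * Z).submatrix I J =
      Matrix.of fun s t => tPow K (x s) * (P₀ * Z).submatrix I' J s t := by
    ext1 s t
    simp only [Matrix.submatrix_apply, Matrix.mul_apply, Matrix.of_apply, hPI, Finset.mul_sum,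
      mul_assoc]
  rw [hsub, Matrix.det_mul_column, ordTop_mul, ordTop_prod, WithTop.coe_sum]
  simp only [ordTop_tPow]

theorem ordTop_det_le_of_minimal_cols {e : Fin r → Fin r → WithTop ℝ} {k : ℕ}
    {I J J' : Fin k → Fin r} {V₀ Z : Matrix (Fin r) (Fin r) (sparseSeries K)}
    (hV₀ : Bounded e V₀)
    (hmin : ∀ V, Bounded e V →
      ordTop ((Z * V₀).submatrix I J).det ≤ ordTop ((Z * V).submatrix I J).det)
    (hJ : Function.Injective J) (he : ∀ i t, e i (J t) ≤ e i (J' t)) :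
    ordTop ((Z * V₀).submatrix I J).det ≤ ordTop ((Z * V₀).submatrix I J').det := by
  have htr : ∀ (V : Matrix (Fin r) (Fin r) (sparseSeries K)) (J : Fin k → Fin r),
      ((Vᵀ * Zᵀ).submatrix J I).det = ((Z * V).submatrix I J).det := by
    intro V J
    rw [← Matrix.transpose_mul, ← Matrix.transpose_submatrix, Matrix.det_transpose]
  have h := ordTop_det_le_of_minimal_rows (e := fun i j => e j i) (I := J) (I' := J') (J := I)
    (P₀ := V₀ᵀ) (Z := Zᵀ) (x := 0) (fun i j => hV₀ j i)
    (fun P hP => by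
      have := hmin Pᵀ fun i j => hP j i
      rwa [← htr, ← htr, Matrix.transpose_transpose] at this)
    hJ (fun s j => by simpa using he j s)
  rw [htr, htr] at h
  simpa using h

/-- The generic matrices of `exists_generic_matrices`, with the inequalities obtained by replacing
rows of `P₀` or columns of `V₀`. -/
theorem exists_generic_product [Infinite K] (e₁ e₂ : Fin r → Fin r → WithTop ℝ)
    (Y Z : Matrix (Fin r) (Fin r) (sparseSeries K)) :
    ∃ P₀ V₀ : Matrix (Fin r) (Fin r) (sparseSeries K), Bounded e₁ P₀ ∧ Bounded e₂ V₀ ∧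
      (∀ k ≤ r, ∀ f g : Fin k → Fin r, ∀ P V, Bounded e₁ P → Bounded e₂ V →
        ordTop ((P₀ * Y * V₀).submatrix f g).det ≤ ordTop ((P * Y * V).submatrix f g).det ∧
        ordTop ((P₀ * Z).submatrix f g).det ≤ ordTop ((P * Z).submatrix f g).det ∧
        ordTop (V₀.submatrix f g).det ≤ ordTop (V.submatrix f g).det) ∧
      (∀ k ≤ r, ∀ I I' J : Fin k → Fin r, Function.Injective I → ∀ x : Fin k → ℝ,
        (∀ s j, e₁ (I s) j ≤ x s + e₁ (I' s) j) → ordTop ((P₀ * Y * V₀).submatrix I J).det ≤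
          ((∑ s, x s : ℝ) : WithTop ℝ) + ordTop ((P₀ * Y * V₀).submatrix I' J).det) ∧
      (∀ k ≤ r, ∀ I J J' : Fin k → Fin r, Function.Injective J →
        (∀ i t, e₂ i (J t) ≤ e₂ i (J' t)) → ordTop ((P₀ * Y * V₀).submatrix I J).det ≤
          ordTop ((P₀ * Y * V₀).submatrix I J').det) := by
  obtain ⟨P₀, V₀, hP₀, hV₀, hmin⟩ := exists_generic_matrices e₁ e₂ Y Z
  refine ⟨P₀, V₀, hP₀, hV₀, hmin, fun k hk I I' J hI x hx => ?_, fun k hk I J J' hJ he => ?_⟩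
  · rw [mul_assoc]
    refine ordTop_det_le_of_minimal_rows hP₀ (fun P hP => ?_) hI hx
    rw [← mul_assoc, ← mul_assoc]
    exact (hmin k hk I J P V₀ hP hV₀).1
  · exact ordTop_det_le_of_minimal_cols hV₀ (fun V hV => (hmin k hk I J P₀ V hP₀ hV).1) hJ he

/-- Clearing denominators in `N⁻¹`. This competitor has nonzero principal minors, which forces the
minimal ones to be nonzero as well. -/
theorem exists_integral_mul_eq_smul_one {N : Matrix (Fin r) (Fin r) (sparseSeries K)}
    (hN : N.det ≠ 0) : ∃ (V : Matrix (Fin r) (Fin r) (sparseSeries K)) (c : sparseSeries K),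
      Integral V ∧ c ≠ 0 ∧ N * V = c • (1 : Matrix (Fin r) (Fin r) (sparseSeries K)) := by
  let s : ℝ := ∑ i, ∑ j, |ord (N⁻¹ i j)|
  refine ⟨tPow K s • N⁻¹, tPow K s, fun i j => ?_, tPow_ne_zero s, ?_⟩
  · rw [Matrix.smul_apply, smul_eq_mul, ordTop_mul, ordTop_tPow]
    by_cases h : N⁻¹ i j = 0
    · simp [h]
    · rw [ordTop_eq_ord h]
      have h1 : |ord (N⁻¹ i j)| ≤ ∑ j, |ord (N⁻¹ i j)| :=
        Finset.single_le_sum (f := fun j => |ord (N⁻¹ i j)|) (fun _ _ => abs_nonneg _)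
          (Finset.mem_univ j)
      have h2 : ∑ j, |ord (N⁻¹ i j)| ≤ s :=
        Finset.single_le_sum (f := fun i => ∑ j, |ord (N⁻¹ i j)|)
          (fun _ _ => Finset.sum_nonneg fun _ _ => abs_nonneg _) (Finset.mem_univ i)
      have h3 := neg_abs_le (ord (N⁻¹ i j))
      have h4 : 0 ≤ s + ord (N⁻¹ i j) := by linarith
      have h5 : (0 : WithTop ℝ) ≤ ((s + ord (N⁻¹ i j) : ℝ) : WithTop ℝ) := by exact_mod_cast h4
      rwa [WithTop.coe_add] at h5
  · rw [Matrix.mul_smul, Matrix.mul_nonsing_inv _ (isUnit_iff_ne_zero.2 hN)]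

theorem det_smul_one_submatrix {k : ℕ} (c : sparseSeries K) {f : Fin k → Fin r}
    (hf : Function.Injective f) :
    ((c • (1 : Matrix (Fin r) (Fin r) (sparseSeries K))).submatrix f f).det = c ^ k := by
  change (c • (1 : Matrix (Fin r) (Fin r) (sparseSeries K)).submatrix f f).det = _
  rw [Matrix.submatrix_one f hf, Matrix.det_smul]
  simp

theorem det_one_submatrix {k : ℕ} {f : Fin k → Fin r} (hf : Function.Injective f) :
    ((1 : Matrix (Fin r) (Fin r) (sparseSeries K)).submatrix f f).det = 1 := by
  rw [Matrix.submatrix_one f hf, Matrix.det_one]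

theorem det_ne_zero_of_minimal {k : ℕ} {N W : Matrix (Fin r) (Fin r) (sparseSeries K)}
    (hN : N.det ≠ 0) {f : Fin k → Fin r} (hf : Function.Injective f)
    (hmin : ∀ V, Integral V →
      ordTop (W.submatrix f f).det ≤ ordTop ((1 * N * V).submatrix f f).det) :
    (W.submatrix f f).det ≠ 0 := by
  obtain ⟨V, c, hV, hc, hNV⟩ := exists_integral_mul_eq_smul_one hN
  have h := hmin V hV
  rw [one_mul, hNV, det_smul_one_submatrix c hf] at h
  intro h0
  rw [h0, ordTop_zero, top_le_iff, ordTop_eq_top] at h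
  exact pow_ne_zero k hc h

theorem rev_castLE_injective {k : ℕ} (hk : k ≤ r) :
    Function.Injective (Fin.rev ∘ Fin.castLE hk) :=
  Fin.rev_injective.comp (Fin.castLE_injective hk)

/-- Invertible matrices over the field of series can be brought to the form `D_μ`. -/
theorem exists_smith_form [Infinite K] {M : Matrix (Fin r) (Fin r) (sparseSeries K)}
    (hM : M.det ≠ 0) : ∃ μ : Fin r → ℝ, Antitone μ ∧ ∃ A ∈ glR r K, ∃ B ∈ glR r K,
      A.val * M * B.val = (diagT K μ).val := by
  obtain ⟨P₀, V₀, hP₀, hV₀, hmin, hrow, hcol⟩ :=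
    exists_generic_product (fun _ _ => 0) (fun _ _ => 0) M 1
  have hone := integral_one (K := K) (r := r)
  have hP₀det : ordTop P₀.det ≤ 0 := by
    have h := (hmin r le_rfl id id 1 1 hone hone).2.1
    simpa using h
  have hV₀det : ordTop V₀.det ≤ 0 := by
    have h := (hmin r le_rfl id id 1 1 hone hone).2.2
    simpa using h
  obtain ⟨p, hp, rfl⟩ := exists_mem_glR hP₀ hP₀det
  obtain ⟨v, hv, rfl⟩ := exists_mem_glR hV₀ hV₀det
  set W := p.val * M * v.val with hW
  have hne : ∀ (k : ℕ) (hk : k ≤ r),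
      (W.submatrix (Fin.castLE hk) (Fin.castLE hk)).det ≠ 0 := fun k hk =>
    det_ne_zero_of_minimal hM (Fin.castLE_injective hk) fun V hV =>
      (hmin k hk _ _ 1 V hone hV).1
  obtain ⟨L₁, hL₁, hlow₁, -, hup₁⟩ := exists_lower_mul_isUpper W hne fun k hk f => by
    simpa using hrow k hk _ f _ (Fin.castLE_injective hk) 0 (by simp)
  have htr : ∀ {k : ℕ} (f g : Fin k → Fin r),
      (Wᵀ.submatrix f g).det = (W.submatrix g f).det := by
    intro k f g
    rw [← Matrix.transpose_submatrix, Matrix.det_transpose]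
  obtain ⟨L₂, hL₂, hlow₂, -, hup₂⟩ := exists_lower_mul_isUpper Wᵀ
    (fun k hk => by rw [htr]; exact hne k hk) fun k hk f => by
      rw [htr, htr]
      exact hcol k hk _ _ f (Fin.castLE_injective hk) (by simp)
  have hlow : IsLower (W * L₂.valᵀ) := by
    have h := hup₂.transpose
    rwa [Matrix.transpose_mul, Matrix.transpose_transpose] at h
  set D := L₁.val * W * L₂.valᵀ with hD
  have hDup : IsUpper D := hup₁.mul hlow₂.transpose
  have hDlow : IsLower D := by
    rw [hD, mul_assoc]
    exact hlow₁.mul hlow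
  have hDdet : D.det ≠ 0 := by
    simp only [hD, hW, Matrix.det_mul, Matrix.det_transpose]
    exact mul_ne_zero (mul_ne_zero (det_units_ne_zero _) (mul_ne_zero
      (mul_ne_zero (det_units_ne_zero _) hM) (det_units_ne_zero _))) (det_units_ne_zero _)
  rw [hDup.det_eq, Finset.prod_ne_zero_iff] at hDdet
  -- Row and column elimination leave `D` both upper and lower triangular; it remains to replace the
  -- diagonal entries by powers of `t` using units, and to sort the exponents.
  have hDdiag : D = Matrix.diagonal fun i => D i i := by
    ext1 i j
    rcases lt_trichotomy i j with h | rfl | h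
    · rw [hDlow i j h, Matrix.diagonal_apply_ne _ h.ne]
    · simp
    · rw [hDup i j h, Matrix.diagonal_apply_ne _ h.ne']
  let ν : Fin r → ℝ := fun i => ord (D i i)
  let u : Fin r → sparseSeries K := fun i => tPow K (ν i) * (D i i)⁻¹
  have hud : ∀ i, u i * D i i = tPow K (ν i) := fun i =>
    inv_mul_cancel_right₀ (hDdet i (Finset.mem_univ i)) _
  have hu : ∀ i, ordTop (u i) = 0 := by
    intro i
    have h := congrArg ordTop (hud i)
    rw [ordTop_mul, ordTop_tPow, ordTop_eq_ord (hDdet i (Finset.mem_univ i))] at h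
    have h' : ordTop (u i) + (ν i : WithTop ℝ) = 0 + (ν i : WithTop ℝ) := by rw [h, zero_add]
    exact (WithTop.add_right_inj WithTop.coe_ne_top).1 h'
  obtain ⟨w, hw, hwu⟩ := exists_mem_glR (W := Matrix.diagonal u)
    (fun i j => by
      by_cases h : i = j
      · subst h
        simp [hu]
      · simp [h])
    (by rw [Matrix.det_diagonal, ordTop_prod]; simp [hu])
  obtain ⟨l, hl, hlL⟩ := exists_mem_glR (W := L₂.valᵀ)
    (fun i j => integral_of_mem_glR hL₂ j i)
    (by rw [Matrix.det_transpose, ordTop_det_of_mem_glR hL₂])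
  have hA' : w * L₁ * p ∈ glR r K := mul_mem (mul_mem hw hL₁) hp
  have hB' : v * l ∈ glR r K := mul_mem hv hl
  have hprod : (w * L₁ * p).val * M * (v * l).val = (diagT K ν).val := by
    have h : (w * L₁ * p).val * M * (v * l).val = w.val * D := by
      simp only [hD, hW, Units.val_mul, hlL, mul_assoc]
    rw [h, hwu, hDdiag, Matrix.diagonal_mul_diagonal]
    simp only [hud]
    rfl
  let σ := Tuple.sort fun i => -ν i
  have hσ : Antitone (ν ∘ σ) := fun a b hab => by
    have h : -ν (σ a) ≤ -ν (σ b) := Tuple.monotone_sort (fun i => -ν i) hab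
    exact neg_le_neg_iff.1 h
  obtain ⟨A, hA, hAv⟩ := exists_mem_glR (W := (w * L₁ * p).val.submatrix (id ∘ σ) id)
    (fun i j => integral_of_mem_glR hA' _ _)
    (by
      rw [ordTop_det_submatrix_comp_perm, Matrix.submatrix_id_id, ordTop_det_of_mem_glR hA'])
  obtain ⟨B, hB, hBv⟩ := exists_mem_glR (W := (v * l).val.submatrix id (id ∘ σ))
    (fun i j => integral_of_mem_glR hB' _ _)
    (by
      rw [← Matrix.det_transpose, Matrix.transpose_submatrix, ordTop_det_submatrix_comp_perm,
        Matrix.submatrix_id_id, Matrix.det_transpose, ordTop_det_of_mem_glR hB'])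
  refine ⟨ν ∘ σ, hσ, A, hA, B, hB, ?_⟩
  have h : A.val * M * B.val = ((w * L₁ * p).val * M * (v * l).val).submatrix σ σ := by
    rw [hAv, hBv]
    ext1 i j
    simp only [Matrix.mul_apply, Matrix.submatrix_apply, Function.comp_apply, id_eq]
  rw [h, hprod]
  exact Matrix.submatrix_diagonal_equiv _ σ

theorem exists_pairEquiv_diagT [Infinite K] {M N : Matrix (Fin r) (Fin r) (sparseSeries K)}
    (hM : M.det ≠ 0) (hN : N.det ≠ 0) :
    ∃ (μ : Fin r → ℝ) (N' : Matrix (Fin r) (Fin r) (sparseSeries K)), Antitone μ ∧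
      N'.det ≠ 0 ∧ PairEquiv M N (diagT K μ).val N' := by
  obtain ⟨μ, hμ, A, hA, B, hB, h⟩ := exists_smith_form hM
  refine ⟨μ, (B⁻¹).val * N, hμ, ?_, A, hA, B⁻¹, inv_mem hB, 1, one_mem _, ?_, ?_⟩
  · rw [Matrix.det_mul]
    exact mul_ne_zero (det_units_ne_zero _) hN
  · rw [inv_inv, h]
  · simp

/-- A lower triangular `T` builds the last `k` columns from the last `k` columns alone, through a
unitriangular block. -/
theorem det_mul_lower_submatrix_lastCols {W T : Matrix (Fin r) (Fin r) (sparseSeries K)}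
    (hT : IsLower T) (hT1 : ∀ i, T i i = 1) {k : ℕ} (hk : k ≤ r) (I : Fin k → Fin r) :
    ((W * T).submatrix I (lastCols hk)).det = (W.submatrix I (lastCols hk)).det := by
  have hsub : (W * T).submatrix I (lastCols hk) =
      W.submatrix I (lastCols hk) * T.submatrix (lastCols hk) (lastCols hk) := by
    ext1 s t
    simp only [Matrix.submatrix_apply, Matrix.mul_apply]
    rw [← Finset.sum_image (s := Finset.univ) (g := lastCols hk)
      (f := fun a => W (I s) a * T a (lastCols hk t)) (lastCols hk).injective.injOn]
    symm
    refine Finset.sum_subset (Finset.subset_univ _) fun a _ ha => ?_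
    rw [hT a _ ?_, mul_zero]
    by_contra! hle
    apply ha
    have hle' : r - k + (t : ℕ) ≤ a := hle
    refine Finset.mem_image.2 ⟨⟨a - (r - k), by omega⟩, Finset.mem_univ _, Fin.ext ?_⟩
    change r - k + ((a : ℕ) - (r - k)) = a
    omega
  have hlow : IsLower (T.submatrix (lastCols hk) (lastCols hk)) :=
    fun i j hij => hT _ _ ((lastCols hk).strictMono hij)
  rw [hsub, Matrix.det_mul, hlow.det_eq]
  simp [hT1]

/-- The bounds on the entries of upper triangular matrices over `R`. -/
noncomputable abbrev upperBound (r : ℕ) (i j : Fin r) : WithTop ℝ := if i ≤ j then 0 else ⊤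

theorem Bounded.isUpper {P : Matrix (Fin r) (Fin r) (sparseSeries K)}
    (h : Bounded (upperBound r) P) : IsUpper P := by
  intro i j hij
  have := h i j
  rwa [upperBound, if_neg hij.not_ge, top_le_iff, ordTop_eq_top] at this

theorem Bounded.mono {e e' : Fin r → Fin r → WithTop ℝ}
    {P : Matrix (Fin r) (Fin r) (sparseSeries K)} (h : Bounded e P) (he : ∀ i j, e' i j ≤ e i j) :
    Bounded e' P := fun i j => (he i j).trans (h i j)

theorem bounded_upperBound_one : Bounded (upperBound r)
    (1 : Matrix (Fin r) (Fin r) (sparseSeries K)) := by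
  intro i j
  rcases eq_or_ne i j with rfl | h
  · simp [upperBound]
  · simp [h]

theorem admissibleBound_le_upperBound {μ : Fin r → ℝ} (hμ : Antitone μ) (i j : Fin r) :
    admissibleBound μ i j ≤ upperBound r i j := by
  by_cases h : i ≤ j
  · rw [upperBound, if_pos h, admissibleBound, max_eq_left (sub_nonpos.2 (hμ h))]
    exact le_rfl
  · rw [upperBound, if_neg h]
    exact le_top

theorem zero_le_admissibleBound (μ : Fin r → ℝ) (i j : Fin r) : 0 ≤ admissibleBound μ i j :=
  WithTop.coe_le_coe.2 (le_max_left _ _)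

/-- A generic admissible `q` and a generic `v` over `R` give `gap`, but not an upper triangular
matrix. Lower triangular column operations repair this without changing right-most minors, and a
second generic choice with upper triangular factors gives `row` and `col` for all minors. -/
theorem exists_isMuGeneric [Infinite K] {μ : Fin r → ℝ} (hμ : Antitone μ)
    {N : Matrix (Fin r) (Fin r) (sparseSeries K)} (hN : N.det ≠ 0) :
    ∃ X, IsMuGeneric μ N X := by
  obtain ⟨Q₀, V₀, hQ₀, hV₀, hmin, hrow, hcol⟩ :=
    exists_generic_product (admissibleBound μ) (fun _ _ => 0) N 1
  have hone := integral_one (K := K) (r := r)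
  have hupone := bounded_upperBound_one (K := K) (r := r)
  have hadone : Bounded (admissibleBound μ) (1 : Matrix (Fin r) (Fin r) (sparseSeries K)) :=
    hupone.mono (admissibleBound_le_upperBound hμ)
  -- Comparison with the identity: all principal minors of the generic admissible matrix are units
  -- of `R`. The triangular factorizations of `Q` come from this.
  have hQ₀minor : ∀ k ≤ r, ∀ f : Fin k → Fin r, Function.Injective f →
      ordTop (Q₀.submatrix f f).det ≤ 0 := by
    intro k hk f hf
    have h := (hmin k hk f f 1 1 hadone hone).2.1
    rwa [mul_one, mul_one, det_one_submatrix hf, ordTop_one] at h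
  have hQ₀int : Integral Q₀ := hQ₀.mono (zero_le_admissibleBound μ)
  obtain ⟨q, hq, rfl⟩ := exists_mem_glR hQ₀int
    (by simpa using hQ₀minor r le_rfl id Function.injective_id)
  obtain ⟨v, hv, rfl⟩ := exists_mem_glR hV₀
    (by simpa using (hmin r le_rfl id id 1 1 hadone hone).2.2)
  set W := q.val * N * v.val with hW
  obtain ⟨T, hT, hTlow, hT1, hTup⟩ := exists_mul_lower_isUpper W
    (fun k hk => det_ne_zero_of_minimal hN (rev_castLE_injective hk) fun V hV =>
      (hmin k hk _ _ 1 V hadone hV).1)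
    (fun k hk f => hcol k hk _ _ f (rev_castLE_injective hk) (by simp))
  -- The last argument `q.val` makes the minors of `u * q` minimal too, so that its leading minors
  -- remain units.
  obtain ⟨U₀, V₂, hU₀, hV₂, hmin₂, hrow₂, hcol₂⟩ :=
    exists_generic_product (upperBound r) (upperBound r) (W * T.val) q.val
  have hupint : ∀ {P : Matrix (Fin r) (Fin r) (sparseSeries K)},
      Bounded (upperBound r) P → Integral P := fun h =>
    (h.mono (admissibleBound_le_upperBound hμ)).mono (zero_le_admissibleBound μ)
  obtain ⟨u, hu, rfl⟩ := exists_mem_glR (hupint hU₀) (by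
    have h := (hmin₂ r le_rfl id id 1 1 hupone hupone).2.1
    simpa [ordTop_mul, ordTop_det_of_mem_glR hq] using h)
  obtain ⟨v₂, hv₂, rfl⟩ := exists_mem_glR (hupint hV₂) (by
    simpa using (hmin₂ r le_rfl id id 1 1 hupone hupone).2.2)
  have huq := mul_mem hu hq
  have hle0 : ∀ {k : ℕ} {f : Fin k → Fin r} {a : sparseSeries K} (g : Fin k → Fin r)
      {P : GL (Fin r) (sparseSeries K)}, P ∈ glR r K → ordTop a ≤ 0 →
      ordTop a ≤ ordTop (P.val.submatrix f g).det := fun g P hP ha =>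
    ha.trans (ordTop_det_nonneg fun i j => integral_of_mem_glR hP _ _)
  have hne0 : ∀ {a : sparseSeries K}, ordTop a ≤ 0 → a ≠ 0 := by
    rintro a ha rfl
    simp at ha
  have huqlead : ∀ (k : ℕ) (hk : k ≤ r),
      ordTop ((u * q).val.submatrix (Fin.castLE hk) (Fin.castLE hk)).det ≤ 0 := by
    intro k hk
    have h := (hmin₂ k hk (Fin.castLE hk) (Fin.castLE hk) 1 1 hupone hupone).2.1
    rw [one_mul] at h
    exact h.trans (hQ₀minor k hk _ (Fin.castLE_injective hk))
  obtain ⟨L, hL, hLlow, -, hLup⟩ := exists_lower_mul_isUpper (u * q).val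
    (fun k hk => hne0 (huqlead k hk)) fun k hk f => hle0 _ huq (huqlead k hk)
  obtain ⟨L', hL', hLlow', -, hLup'⟩ := exists_mul_lower_isUpper q.val
    (fun k hk => hne0 (hQ₀minor k hk _ (rev_castLE_injective hk)))
    fun k hk f => hle0 _ hq (hQ₀minor k hk _ (rev_castLE_injective hk))
  have hlast : ∀ (k : ℕ) (hk : k ≤ r) (I : Fin k ↪o Fin r),
      ordTop (minor (u.val * (W * T.val) * v₂.val) I (lastCols hk)) =
        ordTop (W.submatrix I (lastCols hk)).det ∧ ∀ H : Fin k ↪o Fin r, (∀ s, I s ≤ H s) →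
      ordTop (W.submatrix H (lastCols hk)).det + ((∑ s, μ (H s) : ℝ) : WithTop ℝ) ≤
        ordTop (W.submatrix I (lastCols hk)).det + ((∑ s, μ (I s) : ℝ) : WithTop ℝ) := by
    intro k hk I
    have hgap : ∀ I H : Fin k ↪o Fin r, (∀ s, I s ≤ H s) →
        ordTop (W.submatrix H (lastCols hk)).det + ((∑ s, μ (H s) : ℝ) : WithTop ℝ) ≤
          ordTop (W.submatrix I (lastCols hk)).det + ((∑ s, μ (I s) : ℝ) : WithTop ℝ) := by
      intro I H hIH
      -- Row `I s` times `t ^ (μ (I s) - μ (H s))` satisfies the admissibility bounds of the lower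
      -- row `H s`.
      have h := hrow k hk H I (lastCols hk) H.injective (fun s => μ (I s) - μ (H s)) fun s j => by
        rw [← WithTop.coe_add, WithTop.coe_le_coe]
        refine max_le ?_ ?_
        · exact add_nonneg (sub_nonneg.2 (hμ (hIH s))) (le_max_left _ _)
        · linarith [le_max_right 0 (μ j - μ (I s))]
      have h' := add_le_add_left h ((∑ s, μ (H s) : ℝ) : WithTop ℝ)
      refine h'.trans_eq ?_
      rw [add_right_comm, ← WithTop.coe_add, Finset.sum_sub_distrib, sub_add_cancel, add_comm]
    -- Upper bound: the identity competes with `u` and `v₂`. Lower bound: the right-most minors of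
    -- `W` already satisfy the inequalities under which admissible multiplication cannot lower
    -- orders.
    refine ⟨le_antisymm ?_ ?_, hgap I⟩
    · have h := (hmin₂ k hk I (lastCols hk) 1 1 hupone hupone).1
      rwa [one_mul, mul_one, det_mul_lower_submatrix_lastCols hTlow hT1] at h
    · have h := le_ordTop_det_admissible_mul hμ (W := W) (S := u.val) (T := T.val * v₂.val)
        (w := fun I => ordTop (W.submatrix I (lastCols hk)).det)
        (fun I J => hcol k hk I (lastCols hk) J (lastCols hk).injective (by simp))
        (fun I H hIH => by
          simpa using hrow k hk I H (lastCols hk) I.injective 0 fun s j => by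
            rw [Pi.zero_apply, WithTop.coe_zero, zero_add, WithTop.coe_le_coe]
            exact max_le_max le_rfl (sub_le_sub_left (hμ (hIH s)) _))
        hgap (hU₀.mono (admissibleBound_le_upperBound hμ))
        ((integral_of_mem_glR hT).mul (integral_of_mem_glR hv₂)) I (lastCols hk)
      rwa [show u.val * W * (T.val * v₂.val) = u.val * (W * T.val) * v₂.val by
        simp only [mul_assoc]] at h
  have hkr : ∀ {k : ℕ}, (Fin k ↪o Fin r) → k ≤ r := fun I => by
    simpa using Fintype.card_le_of_injective I I.injective
  refine ⟨u.val * (W * T.val) * v₂.val, (hU₀.isUpper.mul hTup).mul hV₂.isUpper,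
    ⟨u * q, ?_, ?_, ?_, ?_⟩, ?_, ?_, ?_⟩
  · exact (isAdmissible_of_bounded hu (hU₀.mono (admissibleBound_le_upperBound hμ))).mul
      (isAdmissible_of_bounded hq hQ₀)
  -- Upper-lower comes from the trailing minors of `q`, as the upper factor `u` can be absorbed on
  -- the left; lower-upper comes from the leading minors of `u * q`.
  · refine ⟨u * (q * L'), mul_mem hu (mul_mem hq hL'), L'⁻¹, inv_mem hL',
      hU₀.isUpper.mul hLup', hLlow'.inv, by group⟩
  · exact ⟨L⁻¹, inv_mem hL, L * (u * q), mul_mem hL huq, hLlow.inv, hLup, by group⟩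
  · refine ⟨(v * T * v₂)⁻¹, inv_mem (mul_mem (mul_mem hv hT) hv₂), ?_⟩
    simp only [hW, inv_inv, Units.val_mul, mul_assoc]
  · intro k I H J hIH _
    simpa [minor] using hrow₂ k (hkr I) I H J I.injective 0 fun s j => by
      rw [Pi.zero_apply, WithTop.coe_zero, zero_add]
      by_cases h : H s ≤ j
      · simp [upperBound, h, (hIH s).trans h]
      · simp [upperBound, h]
  · intro k I H J _ hHJ
    refine hcol₂ k (hkr I) I J H J.injective fun i t => ?_
    by_cases h : i ≤ H t
    · simp [upperBound, h, h.trans (hHJ t)]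
    · simp [upperBound, h]
  · intro k hk I H hIH
    rw [(hlast k hk I).1, (hlast k hk H).1]
    exact (hlast k hk I).2 H hIH

end Existence

/-! ### Effect of a scalar factor on minors and parts. -/

section Scaling

variable {K : Type*} [Field K] {r : ℕ}

theorem mul_scalarMat (c : sparseSeries K) (X : Matrix (Fin r) (Fin r) (sparseSeries K)) :
    X * scalarMat r c = c • X := by
  rw [scalarMat, ← Matrix.smul_one_eq_diagonal, Matrix.mul_smul, mul_one]

theorem scalarMat_mul (c : sparseSeries K) (X : Matrix (Fin r) (Fin r) (sparseSeries K)) :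
    scalarMat r c * X = c • X := by
  rw [scalarMat, ← Matrix.smul_one_eq_diagonal, Matrix.smul_mul, one_mul]

theorem minor_smul (c : sparseSeries K) (X : Matrix (Fin r) (Fin r) (sparseSeries K)) {k : ℕ}
    (I J : Fin k ↪o Fin r) : minor (c • X) I J = c ^ k * minor X I J := by
  change (c • X.submatrix I J).det = _
  rw [Matrix.det_smul, Fintype.card_fin]
  rfl

theorem IsMuGeneric.smul {μ : Fin r → ℝ} {N X : Matrix (Fin r) (Fin r) (sparseSeries K)}
    (h : IsMuGeneric μ N X) (c : sparseSeries K) : IsMuGeneric μ (c • N) (c • X) where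
  upper i j hij := by rw [Matrix.smul_apply, h.upper i j hij, smul_zero]
  factor := by
    obtain ⟨Q, hQ, hUL, hLU, T, hT, hX⟩ := h.factor
    exact ⟨Q, hQ, hUL, hLU, T, hT, by rw [hX, Matrix.mul_smul, Matrix.smul_mul]⟩
  row k I H J hIH hHJ := by
    rw [minor_smul, minor_smul, ordTop_mul, ordTop_mul]
    gcongr
    exact h.row k I H J hIH hHJ
  col k I H J hIH hHJ := by
    rw [minor_smul, minor_smul, ordTop_mul, ordTop_mul]
    gcongr
    exact h.col k I H J hIH hHJ
  gap k hk I H hIH := by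
    rw [minor_smul, minor_smul, ordTop_mul, ordTop_mul, add_assoc, add_assoc]
    gcongr 1
    exact h.gap k hk I H hIH

theorem PairEquiv.smul_right {M N A B : Matrix (Fin r) (Fin r) (sparseSeries K)}
    (h : PairEquiv M N A B) (c : sparseSeries K) : PairEquiv M (c • N) A (c • B) := by
  obtain ⟨P, hP, Q, hQ, T, hT, hA, hB⟩ := h
  exact ⟨P, hP, Q, hQ, T, hT, hA, by rw [hB, Matrix.mul_smul, Matrix.smul_mul]⟩

theorem PairEquiv.det_ne_zero_right {M N A B : Matrix (Fin r) (Fin r) (sparseSeries K)}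
    (h : PairEquiv M N A B) (hN : N.det ≠ 0) : B.det ≠ 0 := by
  obtain ⟨P, -, Q, -, T, -, -, rfl⟩ := h
  rw [Matrix.det_mul, Matrix.det_mul]
  exact mul_ne_zero (mul_ne_zero (det_units_ne_zero _) hN) (det_units_ne_zero _)

/-- `row` bounds its order by that of the trailing principal minor, a product of nonzero diagonal
entries. Thus `ord` is additive on the minors used below. -/
theorem IsMuGeneric.minor_lastCols_ne_zero {μ : Fin r → ℝ}
    {N X : Matrix (Fin r) (Fin r) (sparseSeries K)} (h : IsMuGeneric μ N X) (hN : N.det ≠ 0)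
    {k : ℕ} (hk : k ≤ r) (I : Fin k ↪o Fin r) : minor X I (lastCols hk) ≠ 0 := by
  have hdet : X.det ≠ 0 := by
    obtain ⟨Q, -, -, -, T, -, hX⟩ := h.factor
    rw [hX, Matrix.det_mul, Matrix.det_mul]
    exact mul_ne_zero (mul_ne_zero (det_units_ne_zero _) hN) (det_units_ne_zero _)
  rw [h.upper.det_eq, Finset.prod_ne_zero_iff] at hdet
  have hlast : minor X (lastCols hk) (lastCols hk) ≠ 0 := by
    have hup : IsUpper (X.submatrix (lastCols hk) (lastCols hk)) :=
      fun i j hij => h.upper _ _ ((lastCols hk).strictMono hij)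
    rw [minor, hup.det_eq]
    exact Finset.prod_ne_zero_iff.2 fun i _ => hdet _ (Finset.mem_univ _)
  have hle := h.row k I (lastCols hk) (lastCols hk) (le_lastCols hk I) fun _ => le_rfl
  intro h0
  rw [h0, ordTop_zero, top_le_iff, ordTop_eq_top] at hle
  exact hlast hle

theorem IsMuGeneric.omitOrd_smul {μ : Fin r → ℝ}
    {N X : Matrix (Fin r) (Fin r) (sparseSeries K)} (h : IsMuGeneric μ N X) (hN : N.det ≠ 0)
    {c : sparseSeries K} (hc : c ≠ 0) (p q : ℕ) :
    omitOrd (c • X) p q = (omitRows r p q).card * ord c + omitOrd X p q := by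
  rw [omitOrd, minor_smul, ord_mul (pow_ne_zero _ hc) (h.minor_lastCols_ne_zero hN _ _), ord_pow hc]
  rfl

/-- The truncated `p - 1` gives `p = 0` the same effect as `p = 1`: row number `0` does not exist.
-/
theorem card_omitRows {p q : ℕ} (hq : q ≤ r) : (omitRows r p q).card = r - (q - (p - 1)) := by
  have hcompl : omitRows r p q =
      (Finset.univ.filter fun x : Fin r => p ≤ (x : ℕ) + 1 ∧ (x : ℕ) + 1 ≤ q)ᶜ := by
    rw [omitRows, Finset.compl_filter]
  have hmap : (Finset.univ.filter fun x : Fin r => p ≤ (x : ℕ) + 1 ∧ (x : ℕ) + 1 ≤ q).map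
      Fin.valEmbedding = Finset.Ico (p - 1) q := by
    ext a
    simp only [Finset.mem_map, Finset.mem_filter, Finset.mem_univ, true_and,
      Fin.valEmbedding_apply, Finset.mem_Ico]
    constructor
    · rintro ⟨x, hx, rfl⟩
      omega
    · rintro ⟨h1, h2⟩
      exact ⟨⟨a, by omega⟩, ⟨by dsimp only; omega, by dsimp only; omega⟩, rfl⟩
  rw [hcompl, Finset.card_compl, Fintype.card_fin, ← Finset.card_map Fin.valEmbedding, hmap,
    Nat.card_Ico]

theorem IsMuGeneric.part_smul {μ : Fin r → ℝ}
    {N X : Matrix (Fin r) (Fin r) (sparseSeries K)} (h : IsMuGeneric μ N X) (hN : N.det ≠ 0)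
    {c : sparseSeries K} (hc : c ≠ 0) {i j : Fin r} (hij : i ≤ j) :
    part (c • X) (i + 1) (j + 1) =
      part X (i + 1) (j + 1) + if i = j then ord c else 0 := by
  have hij' : (i : ℕ) ≤ j := hij
  have hi := i.2
  have hj := j.2
  simp only [part, h.omitOrd_smul hN hc]
  rw [card_omitRows (by omega), card_omitRows (by omega), card_omitRows (by omega),
    card_omitRows (by omega)]
  have h2 : r - ((j : ℕ) + 1 - ((j : ℕ) + 1 - (i + 1) + 1 - 1)) = r - (i + 1) := by omega
  have h3 : r - ((j : ℕ) + 1 - 1 - ((j : ℕ) + 1 - (i + 1) + 1 - 1)) = r - i := by omega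
  have h4 : r - ((j : ℕ) + 1 - ((j : ℕ) + 1 - (i + 1) + 2 - 1)) = r - i := by omega
  rw [h2, h3, h4]
  split_ifs with heq
  -- On the diagonal the first minor would omit the nonexistent row `0`, so it has one row more than
  -- in the case `i < j`; this is the surviving `ord c`.
  · subst heq
    have h1 : r - ((i : ℕ) + 1 - 1 - ((i : ℕ) + 1 - (i + 1) - 1)) = r - (i + 1) + 1 := by omega
    rw [h1]
    push_cast
    ring
  · have hne : (i : ℕ) ≠ j := fun h => heq (Fin.ext h)
    have h1 : r - ((j : ℕ) + 1 - 1 - ((j : ℕ) + 1 - (i + 1) - 1)) = r - (i + 1) := by omega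
    rw [h1]
    ring

end Scaling

/-! ### Existence, uniqueness and scaling of fillings. -/

section Fillings

variable {K : Type*} [Field K] {r : ℕ}

theorem ord_eq_of_ordTop_eq {a b : sparseSeries K} (h : ordTop a = ordTop b) : ord a = ord b := by
  by_cases ha : a = 0
  · subst ha
    rw [ordTop_zero, eq_comm, ordTop_eq_top] at h
    rw [h]
  · have hb : b ≠ 0 := by
      rintro rfl
      rw [ordTop_zero, ordTop_eq_top] at h
      exact ha h
    rw [ordTop_eq_ord ha, ordTop_eq_ord hb] at h
    exact_mod_cast h

theorem IsRightFilling.unique {M N : Matrix (Fin r) (Fin r) (sparseSeries K)} (hM : M.det ≠ 0)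
    {k₁ k₂ : Fin r → Fin r → ℝ} (h₁ : IsRightFilling M N k₁) (h₂ : IsRightFilling M N k₂) :
    k₁ = k₂ := by
  obtain ⟨μ₁, N₁, X₁, hμ₁, hN₁, hX₁, hk₁⟩ := h₁
  obtain ⟨μ₂, N₂, X₂, hμ₂, hN₂, hX₂, hk₂⟩ := h₂
  have homit : ∀ p q, omitOrd X₁ p q = omitOrd X₂ p q := fun p q =>
    ord_eq_of_ordTop_eq (le_antisymm
      (ordTop_minor_le_of_pairEquiv hM hμ₁ hμ₂ hN₁ hN₂ hX₁ hX₂ _ _)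
      (ordTop_minor_le_of_pairEquiv hM hμ₂ hμ₁ hN₂ hN₁ hX₂ hX₁ _ _))
  funext i j
  rw [hk₁, hk₂]
  simp only [part, homit]

theorem exists_isRightFilling [Infinite K] {M N : Matrix (Fin r) (Fin r) (sparseSeries K)}
    (hM : M.det ≠ 0) (hN : N.det ≠ 0) : ∃ k, IsRightFilling M N k := by
  obtain ⟨μ, N', hμ, hN', heq⟩ := exists_pairEquiv_diagT hM hN
  obtain ⟨X, hX⟩ := exists_isMuGeneric hμ hN'
  exact ⟨_, μ, N', X, hμ, heq, hX, fun _ _ => rfl⟩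

theorem IsRightFilling.smul_right {M N : Matrix (Fin r) (Fin r) (sparseSeries K)}
    (hN : N.det ≠ 0) {k : Fin r → Fin r → ℝ} (h : IsRightFilling M N k) {c : sparseSeries K}
    (hc : c ≠ 0) : IsRightFilling M (c • N) fun i j => k i j + if i = j then ord c else 0 := by
  obtain ⟨μ, N', X, hμ, hN', hX, hk⟩ := h
  refine ⟨μ, c • N', c • X, hμ, hN'.smul_right c, hX.smul c, fun i j => ?_⟩
  dsimp only
  rw [hk]
  by_cases hij : i ≤ j
  · rw [if_pos hij, if_pos hij, hX.part_smul (hN'.det_ne_zero_right hN) hc hij]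
  · rw [if_neg hij, if_neg hij, if_neg fun h => hij h.le, add_zero]

theorem existsUnique_isRightFilling_and_smul [Infinite K]
    {M N : Matrix (Fin r) (Fin r) (sparseSeries K)} (hM : M.det ≠ 0) (hN : N.det ≠ 0)
    {c : sparseSeries K} (hc : c ≠ 0) :
    (∃! k, IsRightFilling M N k) ∧
      ∀ k k' : Fin r → Fin r → ℝ, IsRightFilling M N k → IsRightFilling M (c • N) k' →
        (∀ i j, i < j → k' i j = k i j) ∧ ∀ i, k' i i = k i i + ord c := by
  refine ⟨?_, fun k k' hk hk' => ?_⟩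
  · obtain ⟨k, hk⟩ := exists_isRightFilling hM hN
    exact ⟨k, hk, fun _ h => h.unique hM hk⟩
  · obtain rfl := hk'.unique hM (hk.smul_right hN hc)
    exact ⟨fun i j hij => by simp [hij.ne], fun i => by simp⟩

end Fillings

end ValuationFilling

theorem mainTheorem8 {K : Type*} [Field K] [CharZero K] {r : ℕ}
    (M N : Matrix (Fin r) (Fin r) (sparseSeries K)) (hM : M.det ≠ 0) (hN : N.det ≠ 0)
    (c : sparseSeries K) (hc : c ≠ 0) :
    ((∃! k, ValuationFilling.IsRightFilling M N k) ∧
      ∀ k k' : Fin r → Fin r → ℝ, ValuationFilling.IsRightFilling M N k →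
        ValuationFilling.IsRightFilling M (N * ValuationFilling.scalarMat r c) k' →
        (∀ i j, i < j → k' i j = k i j) ∧
          ∀ i, k' i i = k i i + ValuationFilling.ord c) ∧
    ((∃! m, ValuationFilling.IsLeftFilling M N m) ∧
      ∀ m m' : Fin r → Fin r → ℝ, ValuationFilling.IsLeftFilling M N m →
        ValuationFilling.IsLeftFilling (ValuationFilling.scalarMat r c * M) N m' →
        (∀ i j, i < j → m' i j = m i j) ∧
          ∀ i, m' i i = m i i + ValuationFilling.ord c) := by
  -- Characteristic zero provides the infinitely many constants needed for generic choices.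
  have : Infinite K := Infinite.of_injective (Nat.cast : ℕ → K) Nat.cast_injective
  rw [ValuationFilling.mul_scalarMat, ValuationFilling.scalarMat_mul]
  refine ⟨ValuationFilling.existsUnique_isRightFilling_and_smul hM hN hc, ?_⟩
  unfold ValuationFilling.IsLeftFilling
  rw [Matrix.transpose_smul]
  rw [← Matrix.det_transpose] at hM hN
  exact ValuationFilling.existsUnique_isRightFilling_and_smul hN hM hc
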